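/- Let $s\ge 1$, $[\boldsymbol a,\boldsymbol b]=\prod_{j=1}^s[a_j,b_j]$ with $a_j<b_j$, let $\gamma_{\mathfrak u}>0$ ($\mathfrak u\subseteq[s]:=\{1,\dots,s\}$) be weights with $\gamma_\emptyset\le 1$, and let $1\le p,q\le\infty$ with $1/p+1/q=1$. For $f:[\boldsymbol a,\boldsymbol b]\to\mathbb R$ whose mixed partial derivatives $\partial^{|\mathfrak u|}f/\partial\boldsymbol x_{\mathfrak u}$ of order at most one in each variable exist on $[\boldsymbol a,\boldsymbol b]$, put $$\|f\|_{p,s,\boldsymbol\gamma}=\Big(\sum_{\mathfrak u\subseteq[s]}\Big(\frac1{\gamma_{\mathfrak u}}\sup_{\boldsymbol x\in[\boldsymbol a,\boldsymbol b]}\Big|\frac{\partial^{|\mathfrak u|}f}{\partial\boldsymbol x_{\mathfrak u}}(\boldsymbol x)\Big|\Big)^p\Big)^{1/p},\qquad G(N)=\Big(\sum_{\emptyset\ne\mathfrak u\subseteq[s]}\Big(\gamma_{\mathfrak u}\prod_{j\in\mathfrak u}3(b_j-a_j)\log N\Big)^q\Big)^{1/q}$$ (maxima if $p=\infty$, respectively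 $q=\infty$). **Target.** Let $\overline\pi:[\boldsymbol a,\boldsymbol b]\to[0,\infty)$ be a bounded probability density with $|\overline\pi(\boldsymbol x)-\overline\pi(\boldsymbol y)|\le L_{\overline\pi}\|\boldsymbol x-\boldsymbol y\|_\infty^\beta$ for all $\boldsymbol x,\boldsymbol y\in[\boldsymbol a,\boldsymbol b]$, where $\beta\in(0,1]$, and let $\pi=z\,\overline\pi$ with a constant $z>0$ be its unnormalized version. **Hat functions.** Let $m_1,\dots,m_s\ge 1$ be integers, $y_{j,\ell}=a_j+\ell(b_j-a_j)/m_j$ for $0\le\ell\le m_j$, and let $h_{j,\ell}:[a_j,b_j]\to[0,1]$ be the piecewise linear hat function with $h_{j,\ell}(y_{j,\ell})=1$ that vanishes at distance at least $(b_j-a_j)/m_j$ from $y_{j,\ell}$. Let $w_{j,\ell}=\int_{a_j}^{b_j}h_{j,\ell}$, so that $h_{j,\ell}/w_{j,\ell}$ is a probability density, and let $\Phi_{j,\ell}$ be its distribution function and $\Phi_{j,\ell}^{-1}$ the inverse of $\Phi_{j,\ell}$ on the support of $h_{j,\ell}$. The approximation $\sum_{\boldsymbol k}\pi(\boldsymbol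 y_{\boldsymbol k})\prod_jh_{j,k_j}(x_j)$ of $\pi$, where $\boldsymbol k$ ranges over $\mathcal N=\prod_{j=1}^s\{0,\dots,m_j\}$ and $\boldsymbol y_{\boldsymbol k}=(y_{j,k_j})_j$, is the mixture of the densities $\prod_jh_{j,k_j}/w_{j,k_j}$ with coefficients $c_{\boldsymbol k}=\pi(\boldsymbol y_{\boldsymbol k})\prod_jw_{j,k_j}$. Assume $c:=\sum_{\boldsymbol k\in\mathcal N}c_{\boldsymbol k}>0$. **Algorithm.** Let $N\ge 2$ be an integer, $\delta\in(0,N)$, and let $\boldsymbol k_1,\boldsymbol k_2,\dots$ be any ordering of $\mathcal N$ with $c_{\boldsymbol k_1}\ge c_{\boldsymbol k_2}\ge\cdots$. Let $r$ be the smallest number with $\sum_{v=1}^r c_{\boldsymbol k_v}/c\ge 1-\delta/N$, let $N_{\boldsymbol k_v}=\lfloor Nc_{\boldsymbol k_v}/c\rfloor$ for $v<r$ and $N_{\boldsymbol k_r}=N-\sum_{v<r}N_{\boldsymbol k_v}$. Let $(\boldsymbol y_n)_{n\ge 0}$ be a digital $(t,s)$-sequence over $\mathbb F_2$ with nonsingular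 upper triangular generating matrices, and let $$\mathcal A_{N,s}(f)=\frac1c\sum_{v=1}^r\frac{c_{\boldsymbol k_v}}{N_{\boldsymbol k_v}}\sum_{n=0}^{N_{\boldsymbol k_v}-1}f(\Phi_{\boldsymbol k_v}^{-1}(\boldsymbol y_n)),$$ where $\Phi_{\boldsymbol k}^{-1}$ acts in coordinate $j$ as $\Phi_{j,k_j}^{-1}$ and a term with $N_{\boldsymbol k_v}=0$ is $0$. **Claim.** If $\|f\|_{p,s,\boldsymbol\gamma}<\infty$, then $$\Big|\int_{[\boldsymbol a,\boldsymbol b]}f\,\overline\pi\,\mathrm d\boldsymbol x-\mathcal A_{N,s}(f)\Big|\le 2\|f\|_{L_\infty}L_{\overline\pi}\prod_{j=1}^s(b_j-a_j)\max_{j\in[s]}\Big(\frac{b_j-a_j}{m_j}\Big)^\beta+\|f\|_{p,s,\boldsymbol\gamma}\,\frac{\delta+3r-2}{N}\Big[1+5\cdot2^t\log(2N)\,G(N)\Big].$$ -/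

import Mathlib

open scoped ENNReal

noncomputable section

namespace HatQMC

/-! ### Weighted norms built from mixed first-order partial derivatives -/

/-- The `p`-norm, `1 ≤ p ≤ ∞`, of a finite family of extended nonnegative numbers indexed by `S`. -/
def lpAgg {ι : Type*} (p : ℝ≥0∞) (S : Finset ι) (v : ι → ℝ≥0∞) : ℝ≥0∞ :=
  if p = ∞ then ⨆ i ∈ S, v i else (∑ i ∈ S, v i ^ p.toReal) ^ (1 / p.toReal)

/-- The partial derivative `∂g/∂x_j` of a function on the box `[a, b]`
(one-sided on the faces `x_j = a_j` and `x_j = b_j`). -/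
def boxPartial {s : ℕ} (a b : Fin s → ℝ) (j : Fin s) (g : (Fin s → ℝ) → ℝ) :
    (Fin s → ℝ) → ℝ :=
  fun x => derivWithin (fun y => g (Function.update x j y)) (Set.Icc (a j) (b j)) (x j)

/-- The mixed partial derivative `∂^k f / ∂x_{u_1} ⋯ ∂x_{u_k}` for
`u = {u_1 < ⋯ < u_k}`, the derivative in `x_{u_1}` being the outermost one. -/
def mixedPartial {s : ℕ} (a b : Fin s → ℝ) (f : (Fin s → ℝ) → ℝ) (u : Finset (Fin s)) :
    (Fin s → ℝ) → ℝ :=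
  (u.sort (· ≤ ·)).foldr (fun j g => boxPartial a b j g) f

/-- All the mixed partial derivatives `∂^k f / ∂x_{u_1} ⋯ ∂x_{u_k}`, `u_1 < ⋯ < u_k`, exist
at every point of the box `[a, b]`. -/
def HasMixedPartials {s : ℕ} (a b : Fin s → ℝ) (f : (Fin s → ℝ) → ℝ) : Prop :=
  ∀ (u : Finset (Fin s)) (j : Fin s), (∀ i ∈ u, j < i) → ∀ x ∈ Set.Icc a b,
    DifferentiableWithinAt ℝ (fun y => mixedPartial a b f u (Function.update x j y))
      (Set.Icc (a j) (b j)) (x j)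

/-- The `γ`-weighted norm `‖f‖_{p,s,γ}` (possibly infinite): the `p`-norm over all `u ⊆ [s]` of
`γ_u⁻¹ sup_{x ∈ [a, b]} |∂^{|u|} f / ∂x_u (x)|`. -/
def weightedNorm {s : ℕ} (a b : Fin s → ℝ) (γ : Finset (Fin s) → ℝ) (p : ℝ≥0∞)
    (f : (Fin s → ℝ) → ℝ) : ℝ≥0∞ :=
  lpAgg p Finset.univ fun u =>
    (⨆ x ∈ Set.Icc a b, ENNReal.ofReal |mixedPartial a b f u x|) / ENNReal.ofReal (γ u)

/-- The quantity `G_{γ,q,a,b}(N)`: the `q`-norm over all nonempty `u ⊆ [s]` of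
`γ_u ∏_{j ∈ u} (3 (b_j - a_j) log N)`. -/
def Gconst {s : ℕ} (a b : Fin s → ℝ) (γ : Finset (Fin s) → ℝ) (q : ℝ≥0∞) (N : ℕ) : ℝ :=
  (lpAgg q (Finset.univ.filter fun u : Finset (Fin s) => u.Nonempty) fun u =>
    ENNReal.ofReal (γ u * ∏ j ∈ u, (3 * (b j - a j) * Real.log N))).toReal

/-! ### Digital nets and sequences over `𝔽₂` -/

/-- The matrices `C_1, …, C_s` over `𝔽₂` generate a digital `(t, m, s)`-net: whenever
`d_1 + ⋯ + d_s = m - t`, the first `d_1` rows of `C_1`, …, the first `d_s` rows of `C_s` are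
linearly independent. -/
def GeneratesDigitalNet {s : ℕ} (t m : ℕ) (C : Fin s → Matrix (Fin m) (Fin m) (ZMod 2)) : Prop :=
  t ≤ m ∧ ∀ d : Fin s → ℕ, (∑ j, d j) + t = m →
    LinearIndependent (ZMod 2)
      (fun i : {i : Fin s × Fin m // (i.2 : ℕ) < d i.1} => C i.1.1 i.1.2)

/-- The infinite matrices `C_1, …, C_s` over `𝔽₂` (rows and columns numbered from `0`) generate a
digital `(t, s)`-sequence: every column has finitely many nonzero entries and the upper left
`m × m` submatrices generate a digital `(t, m, s)`-net for every `m ≥ t`, `m ≥ 1`. -/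
def GeneratesDigitalSequence {s : ℕ} (t : ℕ) (C : Fin s → Matrix ℕ ℕ (ZMod 2)) : Prop :=
  (∀ j l, ∃ K, ∀ k, K < k → C j k l = 0) ∧
  ∀ m, 1 ≤ m → t ≤ m →
    GeneratesDigitalNet t m fun j => (C j).submatrix (fun k : Fin m => (k : ℕ)) fun l => (l : ℕ)

/-- An infinite matrix is nonsingular upper triangular. -/
def IsNonsingularUpperTriangular (C : Matrix ℕ ℕ (ZMod 2)) : Prop :=
  (∀ k l, l < k → C k l = 0) ∧ ∀ k, C k k ≠ 0

/-- The `k`-th entry of `C n⃗`, where `n⃗` is the vector of binary digits of `n`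
(the digits with number larger than `log₂ n` are zero). -/
def digitalEntry (C : Matrix ℕ ℕ (ZMod 2)) (n k : ℕ) : ZMod 2 :=
  ∑ l ∈ Finset.range (Nat.log 2 n + 1), C k l * ((n / 2 ^ l % 2 : ℕ) : ZMod 2)

/-- The `n`-th point of the sequence generated by `C_1, …, C_s`. -/
def digitalPoint {s : ℕ} (C : Fin s → Matrix ℕ ℕ (ZMod 2)) (n : ℕ) : Fin s → ℝ :=
  fun j => ∑' k : ℕ, ((digitalEntry (C j) n k).val : ℝ) / 2 ^ (k + 1)

/-! ### The algorithm for mixtures `∑_k c_k φ_k` -/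

section Mixture

variable {ι : Type*} [Fintype ι]

/-- The number `r(δ, N)`: with `k_1, k_2, …` the ordering `e` of the indices (numbered from `0`),
the smallest `r` with `∑_{v ≤ r} c_{k_v} / c ≥ 1 - δ / N`, where `c = ∑_k c_k`. -/
def mixRank (c : ι → ℝ) (e : Fin (Fintype.card ι) ≃ ι) (N : ℕ) (δ : ℝ) : ℕ :=
  sInf {r : ℕ | 1 - δ / N ≤
    ∑ v ∈ Finset.univ.filter (fun v : Fin (Fintype.card ι) => (v : ℕ) < r), c (e v) / ∑ k, c k}

/-- The preliminary sample size `⌊N c_k / c⌋`. -/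
def floorSize (c : ι → ℝ) (N : ℕ) (k : ι) : ℕ := ⌊(N : ℝ) * c k / ∑ i, c i⌋₊

/-- The sample size `N_{k_v}` for `v` among the first `r` indices: `⌊N c_k / c⌋` for all but the
last one of them, and what remains of `N` for the last one. -/
def sampleSize (c : ι → ℝ) (e : Fin (Fintype.card ι) ≃ ι) (N : ℕ) (δ : ℝ)
    (v : Fin (Fintype.card ι)) : ℕ :=
  if (v : ℕ) + 1 = mixRank c e N δ then
    N - ∑ w ∈ Finset.univ.filter (fun w : Fin (Fintype.card ι) => w < v), floorSize c N (e w)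
  else floorSize c N (e v)

/-- The algorithm `A_{N,s}(f) = c⁻¹ ∑_{k ∈ L_δ} (c_k / N_k) ∑_{n < N_k} f (Φ_k⁻¹ (y_n))`.
A term with `N_k = 0` (no sample points) is zero. -/
def mixtureQMC {X : Type*} (c : ι → ℝ) (e : Fin (Fintype.card ι) ≃ ι) (Φinv : ι → X → X)
    (y : ℕ → X) (N : ℕ) (δ : ℝ) (f : X → ℝ) : ℝ :=
  1 / (∑ k, c k) *
    ∑ v ∈ Finset.univ.filter (fun v : Fin (Fintype.card ι) => (v : ℕ) < mixRank c e N δ),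
      c (e v) / (sampleSize c e N δ v : ℝ) *
        ∑ n ∈ Finset.range (sampleSize c e N δ v), f (Φinv (e v) (y n))

end Mixture

/-! ### Hat functions on a uniform grid -/

/-- The grid point `y_l = a + l (b - a) / m`. -/
def gridPoint (a b : ℝ) (m l : ℕ) : ℝ := a + l * ((b - a) / m)

/-- The hat function `h_{l,m}` (to be used on `[a, b]`): `1` at `y_l`, `0` at distance at least
`(b - a) / m` from `y_l`, linear in between. -/
def hat (a b : ℝ) (m l : ℕ) (x : ℝ) : ℝ :=
  max 0 (1 - |x - gridPoint a b m l| * (m / (b - a)))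

/-- The integral of `h_{l,m}` over `[a, b]`. -/
def hatMass (a b : ℝ) (m l : ℕ) : ℝ := ∫ x in a..b, hat a b m l x

/-- The probability density on `[a, b]` proportional to `h_{l,m}`. -/
def hatDensity (a b : ℝ) (m l : ℕ) (x : ℝ) : ℝ := hat a b m l x / hatMass a b m l

/-- Its cumulative distribution function. -/
def hatCDF (a b : ℝ) (m l : ℕ) (x : ℝ) : ℝ := ∫ y in a..x, hatDensity a b m l y

/-- The support `[a, b] ∩ [y_{l-1}, y_{l+1}]` of the hat function. -/
def hatSupport (a b : ℝ) (m l : ℕ) : Set ℝ :=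
  Set.Icc a b ∩
    Set.Icc (gridPoint a b m l - (b - a) / m) (gridPoint a b m l + (b - a) / m)

/-- The inverse of the cumulative distribution function, as a map from `[0, 1]` to the support of
the hat function (on which the distribution function is a bijection onto `[0, 1]`). -/
def hatInvCDF (a b : ℝ) (m l : ℕ) : ℝ → ℝ :=
  Function.invFunOn (hatCDF a b m l) (hatSupport a b m l)

/-- The multi-indices `k = (k_1, …, k_s)` with `0 ≤ k_j ≤ m_j`. -/
abbrev MultiIndex {s : ℕ} (m : Fin s → ℕ) : Type := (j : Fin s) → Fin (m j + 1)

/-- The coefficient `c_k = π(y_k) ∏_j ∫ h_{k_j,m_j}` of the product density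
`∏_j h_{k_j,m_j} / ∫ h_{k_j,m_j}` in the hat function approximation `∑_k π(y_k) h_{k,m}`. -/
def hatCoeff {s : ℕ} (a b : Fin s → ℝ) (m : Fin s → ℕ) (π : (Fin s → ℝ) → ℝ)
    (k : MultiIndex m) : ℝ :=
  π (fun j => gridPoint (a j) (b j) (m j) (k j)) * ∏ j, hatMass (a j) (b j) (m j) (k j)

/-- The coordinatewise inverse distribution function `Φ_k⁻¹`. -/
def hatInvCDFVec {s : ℕ} (a b : Fin s → ℝ) (m : Fin s → ℕ) (k : MultiIndex m)
    (z : Fin s → ℝ) : Fin s → ℝ :=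
  fun j => hatInvCDF (a j) (b j) (m j) (k j) (z j)

end HatQMC

end

/-! ### A Koksma–Hlawka inequality for finite signed sums -/

namespace HatQMC

open Set Finset

/-! The error splits into the cost of replacing the density by its normalized hat function
approximation and the quadrature error for the resulting mixture.

Replacement. The product hats form a partition of unity, and only nodes within one mesh width of `x`
contribute at `x`, so Hölder continuity bounds the pointwise error by `L` times the largest mesh
width to the power `β`. Passing to the approximation and normalizing it each cost this bound times
the volume and `‖f‖_∞`; hence the factor 2 (`abs_integral_sub_hatInterp_le`).

Mixture. Let `B₀` bound the component integrals, and let `B₁` bound the unnormalized error `|n I_k -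
∑_{i<n} f(Φ_k⁻¹(y_i))|` for all `n ≤ N`. The discarded components have total weight at most `δ/N`. A
kept component has a weight comparable to its sample size over `N`, or else a weight below `1/N`. So
each of the `r` kept components costs `O((B₀ + B₁)/N)` (`abs_sum_sub_mixtureQMC_le`).

One component. The inverse distribution functions are increasing in each coordinate, so boxes `{x_u
≤ y_u}` pull back to boxes anchored at 0, and the discrepancy of the digital sequence controls the
error with no change of variables in the derivatives of `f`. Since those derivatives are only
assumed to exist and be bounded, nothing is integrated by parts: the integral is replaced by an
average over a dyadic grid with `2^K` nodes per axis, the difference becomes a finite signed sum,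
and a mean value argument in one coordinate at a time gives Koksma–Hlawka (`koksma_hlawka_sum`).
Finally `K → ∞` (`abs_integral_sub_sum_le`).

Discrepancy. An aligned block of `2^m` indices is an affinely shifted digital net, hence exact on
elementary boxes of order at most `m - t` (`card_block_elementary`). Halving a box repeatedly leaves
few pieces that are still cut (`abs_sum_cut_le`), and the binary expansion of `n` splits the first
`n` points into aligned blocks (`abs_discrepancy_le`). Hölder's inequality for the weights then
produces `G(N)`. -/

/-- A mean value estimate for a weighted sum of one-dimensional functions, each evaluated at its
own point. -/
theorem abs_sum_le_of_derivWithin {α : Type*} [Fintype α] {A B D : ℝ} (hAB : A ≤ B)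
    (w p : α → ℝ) (g : α → ℝ → ℝ) (hp : ∀ i, p i ∈ Icc A B)
    (hg : ∀ i, DifferentiableOn ℝ (g i) (Icc A B))
    (hD : ∀ y ∈ Icc A B,
      |∑ i, (if p i ≤ y then w i else 0) * derivWithin (g i) (Icc A B) y| ≤ D) :
    |∑ i, w i * g i (p i)| ≤ |∑ i, w i * g i B| + (B - A) * D := by
  -- `H` moves every point `p i` to `B`, each one starting when `y` passes it. Its right derivative
  -- involves only the points already passed, and a mean value inequality for right derivatives
  -- needs no integrability.
  set H : ℝ → ℝ := fun y => ∑ i, w i * g i (max (p i) y) with hH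
  have hcont : ContinuousOn H (Icc A B) := by
    refine continuousOn_finsetSum _ fun i _ => continuousOn_const.mul ?_
    refine (hg i).continuousOn.comp ((continuous_const.max continuous_id).continuousOn) ?_
    intro y hy
    exact ⟨le_max_of_le_right hy.1, max_le (hp i).2 hy.2⟩
  have hder : ∀ y ∈ Ico A B, HasDerivWithinAt H
      (∑ i, (if p i ≤ y then w i else 0) * derivWithin (g i) (Icc A B) y) (Ici y) y := by
    intro y hy
    refine HasDerivWithinAt.fun_sum fun i _ => ?_
    by_cases h : p i ≤ y
    · simp only [h, if_true]
      refine HasDerivWithinAt.const_mul _ ?_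
      have h1 := ((hg i) y ⟨hy.1, hy.2.le⟩).hasDerivWithinAt
      have h2 : HasDerivWithinAt (g i) (derivWithin (g i) (Icc A B) y) (Ici y) y := by
        refine h1.mono_of_mem_nhdsWithin ?_
        refine Filter.mem_of_superset (Icc_mem_nhdsGE hy.2) (Icc_subset_Icc_left hy.1)
      refine h2.congr (fun z hz => ?_) ?_
      · rw [max_eq_right (h.trans hz)]
      · rw [max_eq_right h]
    · simp only [h, if_false, zero_mul]
      push Not at h
      refine (hasDerivWithinAt_const y (Ici y) (w i * g i (p i))).congr_of_eventuallyEq ?_ ?_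
      · filter_upwards [mem_nhdsWithin_of_mem_nhds (Iio_mem_nhds h)] with z hz
        rw [max_eq_left (le_of_lt hz)]
      · rw [max_eq_left h.le]
  have key := norm_image_sub_le_of_norm_deriv_right_le_segment hcont hder
    (fun y hy => hD y ⟨hy.1, hy.2.le⟩) B ⟨hAB, le_rfl⟩
  have hA : H A = ∑ i, w i * g i (p i) :=
    sum_congr rfl fun i _ => by rw [max_eq_left (hp i).1]
  have hB : H B = ∑ i, w i * g i B :=
    sum_congr rfl fun i _ => by rw [max_eq_right (hp i).2]
  rw [hA, hB, Real.norm_eq_abs, abs_sub_comm] at key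
  have := abs_sub_abs_le_abs_sub (∑ i, w i * g i (p i)) (∑ i, w i * g i B)
  linarith

theorem mixedPartial_empty {s : ℕ} (a b : Fin s → ℝ) (f : (Fin s → ℝ) → ℝ) :
    mixedPartial a b f ∅ = f := by
  simp [mixedPartial]

theorem mixedPartial_insert {s : ℕ} (a b : Fin s → ℝ) (f : (Fin s → ℝ) → ℝ)
    {u : Finset (Fin s)} {j : Fin s} (h : ∀ i ∈ u, j < i) :
    mixedPartial a b f (insert j u) = boxPartial a b j (mixedPartial a b f u) := by
  have hj : j ∉ u := fun hj => lt_irrefl _ (h j hj)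
  unfold mixedPartial
  rw [Finset.sort_insert (r := (· ≤ ·)) (fun i hi => (h i hi).le) hj]
  rfl

theorem update_mem_Icc {s : ℕ} {a b x : Fin s → ℝ} (hx : x ∈ Icc a b) {j : Fin s} {y : ℝ}
    (hy : y ∈ Icc (a j) (b j)) : Function.update x j y ∈ Icc a b := by
  rw [← Set.pi_univ_Icc] at hx ⊢
  intro i _
  by_cases hi : i = j
  · subst hi; simpa using hy
  · simpa [hi] using hx i trivial

theorem HasMixedPartials.differentiableOn {s : ℕ} {a b : Fin s → ℝ} {f : (Fin s → ℝ) → ℝ}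
    (hf : HasMixedPartials a b f) {u : Finset (Fin s)} {j : Fin s} (h : ∀ i ∈ u, j < i)
    {x : Fin s → ℝ} (hx : x ∈ Icc a b) :
    DifferentiableOn ℝ (fun y => mixedPartial a b f u (Function.update x j y))
      (Icc (a j) (b j)) := by
  intro y hy
  simpa using hf u j h _ (update_mem_Icc hx hy)

theorem boxPartial_update {s : ℕ} (a b : Fin s → ℝ) (g : (Fin s → ℝ) → ℝ) (j : Fin s)
    (x : Fin s → ℝ) (y : ℝ) :
    boxPartial a b j g (Function.update x j y) =
      derivWithin (fun y => g (Function.update x j y)) (Icc (a j) (b j)) y := by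
  simp [boxPartial]

/-- The coordinates with number less than `k`. -/
def firstCoords (s k : ℕ) : Finset (Fin s) := univ.filter fun j => (j : ℕ) < k

theorem firstCoords_succ {s k : ℕ} (hk : k < s) :
    firstCoords s (k + 1) = insert ⟨k, hk⟩ (firstCoords s k) := by
  ext j
  simp only [firstCoords, Finset.mem_filter, Finset.mem_univ, true_and, Finset.mem_insert,
    Fin.ext_iff]
  omega

/-- Induction on the number of coordinates in which the points may still differ. The mean value
estimate in coordinate `k` gives a term with that coordinate frozen at its upper end, and a term
with one more derivative and the weights restricted to `X i k ≤ y`. Coordinates are removed from the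
last to the first because `mixedPartial` has its smallest index outermost. Once all points coincide,
only the total weight matters. -/
theorem abs_sum_mixedPartial_le {s : ℕ} {a b : Fin s → ℝ} (hab : ∀ j, a j ≤ b j)
    {f : (Fin s → ℝ) → ℝ} (hf : HasMixedPartials a b f) {M : Finset (Fin s) → ℝ}
    (hM : ∀ u, ∀ x ∈ Icc a b, |mixedPartial a b f u x| ≤ M u) {α : Type*} [Fintype α] (k : ℕ)
    (hk : k ≤ s) : ∀ (v : Finset (Fin s)) (_ : ∀ j ∈ v, k ≤ (j : ℕ)) (w : α → ℝ)
    (X : α → Fin s → ℝ) (_ : ∀ i, X i ∈ Icc a b) (x₀ : Fin s → ℝ) (_ : x₀ ∈ Icc a b)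
    (_ : ∀ i (j : Fin s), k ≤ (j : ℕ) → X i j = x₀ j) (D : Finset (Fin s) → ℝ)
    (_ : ∀ u ⊆ firstCoords s k, ∀ y : Fin s → ℝ,
      |∑ i, if ∀ j ∈ u, X i j ≤ y j then w i else 0| ≤ D u),
    |∑ i, w i * mixedPartial a b f v (X i)| ≤
      ∑ u ∈ (firstCoords s k).powerset, M (u ∪ v) * (∏ j ∈ u, (b j - a j)) * D u := by
  classical
  induction k with
  | zero =>
    intro v _ w X hX x₀ hx₀ hXx D hD
    have h0 : firstCoords s 0 = ∅ := by simp [firstCoords]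
    have hX0 : ∀ i, X i = x₀ := fun i => funext fun j => hXx i j (Nat.zero_le _)
    have hd := hD ∅ (Finset.empty_subset _) x₀
    simp only [Finset.notMem_empty, false_implies, implies_true, if_true] at hd
    simp only [h0, hX0, ← Finset.sum_mul, Finset.powerset_empty, Finset.sum_singleton,
      Finset.empty_union, Finset.prod_empty, mul_one, abs_mul]
    rw [mul_comm]
    exact mul_le_mul (hM v x₀ hx₀) hd (abs_nonneg _) ((abs_nonneg _).trans (hM v x₀ hx₀))
  | succ k ih =>
    intro v hv w X hX x₀ hx₀ hXx D hD
    have hks : k < s := hk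
    set j : Fin s := ⟨k, hks⟩ with hj
    have hjv : ∀ i ∈ v, j < i := fun i hi => by
      have := hv i hi
      exact Fin.lt_def.2 this
    have hjF : j ∉ firstCoords s k := by simp [firstCoords, hj]
    have hne : ∀ {u}, u ⊆ firstCoords s k → ∀ i ∈ u, i ≠ j := fun hu i hi h =>
      hjF (h ▸ hu hi)
    have hmem : ∀ i, X i j ∈ Icc (a j) (b j) := fun i => ⟨(hX i).1 j, (hX i).2 j⟩
    have upd : ∀ y, y ∈ Icc (a j) (b j) → ∀ (i : α) (l : Fin s), k ≤ (l : ℕ) →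
        Function.update (X i) j y l = Function.update x₀ j y l := by
      intro y _ i l hl
      by_cases hlj : l = j
      · subst hlj; simp
      · have : (l : ℕ) ≠ k := fun h => hlj (Fin.ext h)
        simp only [Function.update_of_ne hlj]
        exact hXx i l (by omega)
    have h1 := abs_sum_le_of_derivWithin (hab j) w (fun i => X i j)
      (fun i y => mixedPartial a b f v (Function.update (X i) j y)) hmem
      (fun i => hf.differentiableOn hjv (hX i))
      (D := ∑ u ∈ (firstCoords s k).powerset,
        M (u ∪ insert j v) * (∏ i ∈ u, (b i - a i)) * D (insert j u)) ?_
    · simp only [Function.update_eq_self] at h1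
      have hb : b j ∈ Icc (a j) (b j) := ⟨hab j, le_rfl⟩
      have h2 := ih hks.le v (fun i hi => (Nat.le_succ k).trans (hv i hi)) w
        (fun i => Function.update (X i) j (b j)) (fun i => update_mem_Icc (hX i) hb)
        (Function.update x₀ j (b j)) (update_mem_Icc hx₀ hb) (upd _ hb) D ?_
      · rw [firstCoords_succ hks, Finset.sum_powerset_insert hjF]
        refine h1.trans (add_le_add h2 (le_of_eq ?_))
        rw [Finset.mul_sum]
        refine Finset.sum_congr rfl fun u hu => ?_
        have hju : j ∉ u := fun h => hne (Finset.mem_powerset.1 hu) j h rfl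
        rw [Finset.prod_insert hju, Finset.union_insert, Finset.insert_union]
        ring
      · intro u hu y
        convert hD u (hu.trans (by rw [firstCoords_succ hks]; exact Finset.subset_insert _ _)) y
          using 5 with i _
        refine imp_congr_right fun hl => ?_
        rw [Function.update_of_ne (hne hu _ hl)]
    · intro y hy
      have h3 := ih hks.le (insert j v)
        (fun i hi => (Finset.mem_insert.1 hi).elim (fun h => by rw [h])
          fun h => (Nat.le_succ k).trans (hv i h))
        (fun i => if X i j ≤ y then w i else 0)
        (fun i => Function.update (X i) j y) (fun i => update_mem_Icc (hX i) hy)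
        (Function.update x₀ j y) (update_mem_Icc hx₀ hy) (upd _ hy) (fun u => D (insert j u)) ?_
      · simpa only [mixedPartial_insert a b f hjv, boxPartial_update] using h3
      · intro u hu y'
        have := hD (insert j u) (by
          rw [firstCoords_succ hks]; exact Finset.insert_subset_insert _ hu)
          (Function.update y' j y)
        refine le_of_eq_of_le (congrArg _ (Finset.sum_congr rfl fun i _ => ?_)) this
        rw [← ite_and]
        refine if_congr ?_ rfl rfl
        rw [Finset.forall_mem_insert, Function.update_self, and_comm]
        refine and_congr_right fun _ => forall₂_congr fun l hl => ?_
        rw [Function.update_of_ne (hne hu l hl), Function.update_of_ne (hne hu l hl)]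

/-- A Koksma–Hlawka inequality for a finite signed sum of point evaluations. -/
theorem koksma_hlawka_sum {s : ℕ} {a b : Fin s → ℝ} (hab : ∀ j, a j ≤ b j)
    {f : (Fin s → ℝ) → ℝ} (hf : HasMixedPartials a b f) {M : Finset (Fin s) → ℝ}
    (hM : ∀ u, ∀ x ∈ Icc a b, |mixedPartial a b f u x| ≤ M u) {α : Type*} [Fintype α]
    (w : α → ℝ) (X : α → Fin s → ℝ) (hX : ∀ i, X i ∈ Icc a b) (D : Finset (Fin s) → ℝ)
    (hD : ∀ u, ∀ y : Fin s → ℝ, |∑ i, if ∀ j ∈ u, X i j ≤ y j then w i else 0| ≤ D u) :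
    |∑ i, w i * f (X i)| ≤ ∑ u, M u * (∏ j ∈ u, (b j - a j)) * D u := by
  have h := abs_sum_mixedPartial_le hab hf hM s le_rfl ∅ (by simp) w X hX a
    ⟨le_rfl, hab⟩ (fun i j hj => absurd j.2 (not_lt.2 hj)) D (fun u _ => hD u)
  have hs : firstCoords s s = Finset.univ := by ext j; simp [firstCoords]
  simpa [mixedPartial_empty, hs] using h

end HatQMC

/-! ### Cutting elementary dyadic boxes -/

namespace HatQMC

open Finset

/-- Bound for the number of unresolved elementary boxes when an elementary box is cut along `r`
coordinates with `κ` remaining subdivisions. -/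
def cutCount : ℕ → ℕ → ℕ
  | 0, _ => 0
  | _ + 1, 0 => 1
  | r + 1, κ + 1 => cutCount (r + 1) κ + cutCount r κ

/-- The Pascal-type recursion closes because `(κ+1)^(r+1) + (κ+1)^r = (κ+2)(κ+1)^r`. -/
theorem cutCount_succ_le (r κ : ℕ) : cutCount (r + 1) κ ≤ (κ + 1) ^ r := by
  induction κ generalizing r with
  | zero => simp [cutCount]
  | succ κ ih =>
    rw [cutCount]
    cases r with
    | zero => simpa [cutCount] using ih 0
    | succ r =>
      calc cutCount (r + 1 + 1) κ + cutCount (r + 1) κ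
          ≤ (κ + 1) ^ (r + 1) + (κ + 1) ^ r := add_le_add (ih _) (ih _)
        _ = (κ + 1 + 1) * (κ + 1) ^ r := by ring
        _ ≤ (κ + 1 + 1) * (κ + 1 + 1) ^ r := by gcongr; omega
        _ = _ := by ring

theorem div_two_pow_eq_iff {K d x c : ℕ} (hd : d < K) :
    x / 2 ^ (K - d) = c ↔ x / 2 ^ (K - (d + 1)) = 2 * c ∨ x / 2 ^ (K - (d + 1)) = 2 * c + 1 := by
  have h : 2 ^ (K - d) = 2 ^ (K - (d + 1)) * 2 := by
    rw [← pow_succ]; congr 1; omega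
  rw [h, ← Nat.div_div_eq_div_mul]
  omega

theorem forall_update_div_iff {s : ℕ} {K : ℕ} (d c x : Fin s → ℕ) (j : Fin s) (d' c' : ℕ) :
    (∀ i, x i / 2 ^ (K - Function.update d j d' i) = Function.update c j c' i) ↔
      x j / 2 ^ (K - d') = c' ∧ ∀ i, i ≠ j → x i / 2 ^ (K - d i) = c i := by
  constructor
  · intro h
    refine ⟨by simpa using h j, fun i hi => by simpa [hi] using h i⟩
  · rintro ⟨h1, h2⟩ i
    by_cases hi : i = j
    · subst hi; simpa using h1
    · simpa [hi] using h2 i hi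

theorem forall_div_two_pow_iff {s : ℕ} {K : ℕ} (d c x : Fin s → ℕ) (j : Fin s) (hd : d j < K) :
    (∀ i, x i / 2 ^ (K - d i) = c i) ↔
      (∀ i, x i / 2 ^ (K - Function.update d j (d j + 1) i) =
        Function.update c j (2 * c j) i) ∨
      (∀ i, x i / 2 ^ (K - Function.update d j (d j + 1) i) =
        Function.update c j (2 * c j + 1) i) := by
  rw [forall_update_div_iff, forall_update_div_iff, ← or_and_right, ← div_two_pow_eq_iff hd]
  have := forall_update_div_iff (K := K) d c x j (d j) (c j)
  rwa [Function.update_eq_self, Function.update_eq_self] at this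

open Classical in
/-- If two nonnegative weightings agree on all dyadic elementary boxes of order at most `k`, then
they almost agree on every elementary box cut by upper bounds in some of the coordinates. -/
theorem abs_sum_cut_le {s : ℕ} {α : Type*} [Fintype α] (L : α → Fin s → ℕ) (w₁ w₂ : α → ℝ)
    (h₁ : ∀ i, 0 ≤ w₁ i) (h₂ : ∀ i, 0 ≤ w₂ i) {K k : ℕ} (hk : k ≤ K) {τ : ℝ} (hτ : 0 ≤ τ)
    (f₁ : ∀ d c : Fin s → ℕ, ∑ j, d j ≤ k → (∀ j, c j < 2 ^ d j) →
      (∑ i, if ∀ j, L i j / 2 ^ (K - d j) = c j then w₁ i else 0) = τ * 2 ^ (k - ∑ j, d j))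
    (f₂ : ∀ d c : Fin s → ℕ, ∑ j, d j ≤ k → (∀ j, c j < 2 ^ d j) →
      (∑ i, if ∀ j, L i j / 2 ^ (K - d j) = c j then w₂ i else 0) = τ * 2 ^ (k - ∑ j, d j))
    (T : Finset (Fin s)) (Λ : Fin s → ℕ) : ∀ (κ : ℕ) (d c : Fin s → ℕ), ∑ j, d j + κ = k →
      (∀ j, c j < 2 ^ d j) →
      |∑ i, if (∀ j, L i j / 2 ^ (K - d j) = c j) ∧ ∀ j ∈ T, L i j < Λ j then w₁ i - w₂ i else 0|
        ≤ τ * cutCount T.card κ := by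
  induction T using Finset.induction with
  | empty =>
    intro κ d c hd hc
    have h : ∀ i, (if (∀ j, L i j / 2 ^ (K - d j) = c j) ∧ ∀ j ∈ (∅ : Finset (Fin s)), L i j < Λ j
        then w₁ i - w₂ i else 0) = (if ∀ j, L i j / 2 ^ (K - d j) = c j then w₁ i else 0) -
          (if ∀ j, L i j / 2 ^ (K - d j) = c j then w₂ i else 0) := by
      intro i
      simp only [Finset.notMem_empty, false_implies, implies_true, and_true]
      split_ifs <;> simp
    simp only [h, Finset.sum_sub_distrib, f₁ d c (by omega) hc, f₂ d c (by omega) hc, sub_self,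
      abs_zero]
    positivity
  | insert j T hj ihT =>
    intro κ
    rw [Finset.card_insert_of_notMem hj]
    induction κ with
    | zero =>
      intro d c hd hc
      -- A box of the finest order `k` carries mass exactly `τ` under both weightings, so both cut
      -- masses lie in `[0, τ]`.
      have key : ∀ w : α → ℝ, (∀ i, 0 ≤ w i) →
          (∑ i, if ∀ j, L i j / 2 ^ (K - d j) = c j then w i else 0) = τ * 2 ^ (k - ∑ j, d j) →
          0 ≤ (∑ i, if (∀ j, L i j / 2 ^ (K - d j) = c j) ∧ ∀ l ∈ insert j T, L i l < Λ l
            then w i else 0) ∧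
          (∑ i, if (∀ j, L i j / 2 ^ (K - d j) = c j) ∧ ∀ l ∈ insert j T, L i l < Λ l
            then w i else 0) ≤ τ := by
        intro w hw hf
        refine ⟨Finset.sum_nonneg fun i _ => by split_ifs <;> simp [hw], ?_⟩
        have : k - ∑ j, d j = 0 := by omega
        rw [this, pow_zero, mul_one] at hf
        rw [← hf]
        refine Finset.sum_le_sum fun i _ => ?_
        split_ifs with h1 h2 h2
        · exact le_rfl
        · exact absurd h1.1 h2
        · exact hw i
        · exact le_rfl
      have k1 := key w₁ h₁ (f₁ d c (by omega) hc)
      have k2 := key w₂ h₂ (f₂ d c (by omega) hc)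
      have h : ∀ i, (if (∀ j, L i j / 2 ^ (K - d j) = c j) ∧ ∀ l ∈ insert j T, L i l < Λ l
          then w₁ i - w₂ i else 0) =
          (if (∀ j, L i j / 2 ^ (K - d j) = c j) ∧ ∀ l ∈ insert j T, L i l < Λ l
            then w₁ i else 0) -
          (if (∀ j, L i j / 2 ^ (K - d j) = c j) ∧ ∀ l ∈ insert j T, L i l < Λ l
            then w₂ i else 0) := by
        intro i
        split_ifs <;> simp
      simp only [h, Finset.sum_sub_distrib, cutCount, Nat.cast_one, mul_one]
      rw [abs_le]
      constructor <;> linarith [k1.1, k1.2, k2.1, k2.2]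
    | succ κ ih =>
      intro d c hd hc
      have hdj : d j ≤ ∑ i, d i := Finset.single_le_sum (fun _ _ => Nat.zero_le _) (mem_univ j)
      have hdK : d j < K := by omega
      -- The box is halved in direction `j`; `c₀` and `c₁` are the lower and upper halves, separated
      -- at `(2 c_j + 1) 2^(K - d_j - 1)`.
      set d' := Function.update d j (d j + 1) with hd'
      set c₀ := Function.update c j (2 * c j) with hc₀
      set c₁ := Function.update c j (2 * c j + 1) with hc₁
      have hsum : ∑ i, d' i + κ = k := by
        rw [hd', Finset.sum_update_of_mem (mem_univ j)]
        rw [Finset.sum_eq_add_sum_sdiff_singleton_of_mem (mem_univ j) d] at hd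
        omega
      have hcc : ∀ e, e ≤ 1 → ∀ i, Function.update c j (2 * c j + e) i < 2 ^ d' i := by
        intro e he i
        by_cases hi : i = j
        · subst hi
          have := hc i
          simp only [hd', Function.update_self, pow_succ]
          omega
        · simpa [hd', hi] using hc i
      have hlt₀ := hcc 0 (by omega)
      have hlt₁ := hcc 1 le_rfl
      have split := fun x => forall_div_two_pow_iff (K := K) d c x j hdK
      have hpos : 0 < 2 ^ (K - (d j + 1)) := by positivity
      have b₀ : ∀ x : Fin s → ℕ, (∀ i, x i / 2 ^ (K - d' i) = c₀ i) →
          x j < (2 * c j + 1) * 2 ^ (K - (d j + 1)) := by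
        intro x hx
        have := hx j
        simp only [hd', hc₀, Function.update_self] at this
        rw [← Nat.div_lt_iff_lt_mul hpos]
        omega
      have b₁ : ∀ x : Fin s → ℕ, (∀ i, x i / 2 ^ (K - d' i) = c₁ i) →
          (2 * c j + 1) * 2 ^ (K - (d j + 1)) ≤ x j := by
        intro x hx
        have := hx j
        simp only [hd', hc₁, Function.update_self] at this
        rw [← Nat.le_div_iff_mul_le hpos]
        omega
      rw [cutCount, Nat.cast_add, mul_add]
      -- A bound below the midpoint leaves the upper half empty. Otherwise the lower half satisfies
      -- the bound on `j` automatically and is cut only along `T`, while the upper half is still cut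
      -- along `insert j T`. This is the recursion of `cutCount`.
      by_cases hΛ : Λ j ≤ (2 * c j + 1) * 2 ^ (K - (d j + 1))
      · have e : ∀ i, ((∀ j, L i j / 2 ^ (K - d j) = c j) ∧ ∀ l ∈ insert j T, L i l < Λ l) ↔
            ((∀ j, L i j / 2 ^ (K - d' j) = c₀ j) ∧ ∀ l ∈ insert j T, L i l < Λ l) := by
          intro i
          rw [split (L i)]
          constructor
          · rintro ⟨h | h, h'⟩
            · exact ⟨h, h'⟩
            · have := h' j (Finset.mem_insert_self _ _)
              have := b₁ _ h
              omega
          · rintro ⟨h, h'⟩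
            exact ⟨Or.inl h, h'⟩
        simp only [e]
        have := ih d' c₀ hsum hlt₀
        have h0 : 0 ≤ τ * (cutCount T.card κ : ℝ) := by positivity
        linarith
      · have e : ∀ i, (if (∀ j, L i j / 2 ^ (K - d j) = c j) ∧ ∀ l ∈ insert j T, L i l < Λ l
            then w₁ i - w₂ i else 0) =
            (if (∀ j, L i j / 2 ^ (K - d' j) = c₁ j) ∧ ∀ l ∈ insert j T, L i l < Λ l
              then w₁ i - w₂ i else 0) +
            (if (∀ j, L i j / 2 ^ (K - d' j) = c₀ j) ∧ ∀ j ∈ T, L i j < Λ j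
              then w₁ i - w₂ i else 0) := by
          intro i
          by_cases g₀ : ∀ j, L i j / 2 ^ (K - d' j) = c₀ j
          · have g₁ : ¬ ∀ j, L i j / 2 ^ (K - d' j) = c₁ j := fun h => by
              have := b₀ _ g₀
              have := b₁ _ h
              omega
            have g : ∀ j, L i j / 2 ^ (K - d j) = c j := (split (L i)).2 (Or.inl g₀)
            have hlt : L i j < Λ j := by have := b₀ _ g₀; omega
            have e₁ : ∀ P : Prop, ¬((∀ j, L i j / 2 ^ (K - d' j) = c₁ j) ∧ P) := fun P h => g₁ h.1
            rw [if_neg (e₁ _), zero_add]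
            refine if_congr ?_ rfl rfl
            rw [Finset.forall_mem_insert]
            exact ⟨fun h => ⟨g₀, h.2.2⟩, fun h => ⟨g, hlt, h.2⟩⟩
          · have e₀ : ∀ P : Prop, ¬((∀ j, L i j / 2 ^ (K - d' j) = c₀ j) ∧ P) := fun P h => g₀ h.1
            rw [if_neg (e₀ _), add_zero]
            refine if_congr ?_ rfl rfl
            exact and_congr_left fun _ => (split (L i)).trans (or_iff_right g₀)
        simp only [e, Finset.sum_add_distrib]
        exact (abs_add_le _ _).trans
          (add_le_add (ih d' c₁ hsum hlt₁) (ihT κ d' c₀ hsum hlt₀))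

end HatQMC

/-! ### Binary digits and equidistribution of aligned blocks -/

namespace HatQMC

open Finset

/-- The integer with the binary digits `v 0, …, v (k - 1)`, most significant digit first. -/
def binVal (v : ℕ → ℕ) : ℕ → ℕ
  | 0 => 0
  | k + 1 => 2 * binVal v k + v k

theorem binVal_lt {v : ℕ → ℕ} (hv : ∀ k, v k < 2) (k : ℕ) : binVal v k < 2 ^ k := by
  induction k with
  | zero => simp [binVal]
  | succ k ih => have := hv k; rw [binVal, pow_succ]; omega

theorem binVal_div {v : ℕ → ℕ} (hv : ∀ k, v k < 2) {d K : ℕ} (h : d ≤ K) :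
    binVal v K / 2 ^ (K - d) = binVal v d := by
  induction K, h using Nat.le_induction with
  | base => simp
  | succ K hK ih =>
    have h1 : 2 ^ (K + 1 - d) = 2 * 2 ^ (K - d) := by
      rw [← pow_succ']; congr 1; omega
    have := hv K
    rw [h1, ← Nat.div_div_eq_div_mul, binVal]
    have h2 : (2 * binVal v K + v K) / 2 = binVal v K := by omega
    rw [h2, ih]

/-- Turns membership in an elementary interval into prescribed values for the first `d` digits, that
is, into linear equations over `𝔽₂`. -/
theorem binVal_eq_iff {v : ℕ → ℕ} (hv : ∀ k, v k < 2) (d : ℕ) : ∀ c, c < 2 ^ d →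
    (binVal v d = c ↔ ∀ k < d, v k = c / 2 ^ (d - 1 - k) % 2) := by
  induction d with
  | zero => intro c hc; simp at hc; simp [binVal, hc]
  | succ d ih =>
    intro c hc
    rw [pow_succ] at hc
    have h1 := ih (c / 2) (by omega)
    have hd := hv d
    have h2 : binVal v (d + 1) = c ↔ binVal v d = c / 2 ∧ v d = c % 2 := by
      rw [binVal]; omega
    rw [h2, h1, Nat.forall_lt_succ_right]
    have h3 : c / 2 ^ (d + 1 - 1 - d) % 2 = c % 2 := by simp
    rw [h3]
    refine and_congr_left fun _ => forall₂_congr fun k hk => ?_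
    have h4 : 2 ^ (d + 1 - 1 - k) = 2 * 2 ^ (d - 1 - k) := by
      rw [← pow_succ']; congr 1; omega
    rw [h4, Nat.div_div_eq_div_mul]

theorem sum_range_div_two_pow (v : ℕ → ℕ) (K : ℕ) :
    ∑ k ∈ range K, (v k : ℝ) / 2 ^ (k + 1) = (binVal v K : ℝ) / 2 ^ K := by
  induction K with
  | zero => simp [binVal]
  | succ K ih =>
    rw [Finset.sum_range_succ, ih, binVal]
    push_cast
    field_simp
    ring

theorem digitalEntry_eq_sum_range (C : Matrix ℕ ℕ (ZMod 2)) {n W : ℕ} (h : n < 2 ^ W) (k : ℕ) :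
    digitalEntry C n k = ∑ l ∈ range W, C k l * ((n / 2 ^ l % 2 : ℕ) : ZMod 2) := by
  have key : ∀ A B : ℕ, A ≤ B → n < 2 ^ A →
      ∑ l ∈ range A, C k l * ((n / 2 ^ l % 2 : ℕ) : ZMod 2) =
        ∑ l ∈ range B, C k l * ((n / 2 ^ l % 2 : ℕ) : ZMod 2) := by
    intro A B hAB hA
    refine Finset.sum_subset (Finset.range_subset_range.2 hAB) fun l _ hl => ?_
    have hl' : A ≤ l := by simpa using hl
    have : n < 2 ^ l := hA.trans_le (Nat.pow_le_pow_right (by norm_num) hl')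
    rw [Nat.div_eq_of_lt this]
    simp
  have hlog : n < 2 ^ (Nat.log 2 n + 1) := Nat.lt_pow_succ_log_self (by norm_num) n
  unfold digitalEntry
  rcases le_total (Nat.log 2 n + 1) W with hW | hW
  · exact key _ _ hW hlog
  · exact (key _ _ hW h).symm

/-- The digits of the coordinates of the points, as natural numbers. -/
def digitalDigit (C : Matrix ℕ ℕ (ZMod 2)) (n k : ℕ) : ℕ := (digitalEntry C n k).val

theorem digitalDigit_lt (C : Matrix ℕ ℕ (ZMod 2)) (n k : ℕ) : digitalDigit C n k < 2 :=
  ZMod.val_lt _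

theorem digitalDigit_eq_zero {C : Matrix ℕ ℕ (ZMod 2)} (hC : IsNonsingularUpperTriangular C)
    {n K k : ℕ} (hn : n < 2 ^ K) (hk : K ≤ k) : digitalDigit C n k = 0 := by
  rw [digitalDigit, digitalEntry_eq_sum_range C hn, Finset.sum_eq_zero, ZMod.val_zero]
  intro l hl
  rw [hC.1 k l ((mem_range.1 hl).trans_le hk), zero_mul]

/-- Upper triangularity makes the digits from position `K` on vanish for `n < 2 ^ K`, so the series
is finite and the point is exactly a node of the grid of mesh `2 ^ (-K)`. -/
theorem digitalPoint_eq {s : ℕ} {C : Fin s → Matrix ℕ ℕ (ZMod 2)}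
    (hC : ∀ j, IsNonsingularUpperTriangular (C j)) {n K : ℕ} (hn : n < 2 ^ K) (j : Fin s) :
    digitalPoint C n j = (binVal (digitalDigit (C j) n) K : ℝ) / 2 ^ K := by
  rw [← sum_range_div_two_pow]
  refine tsum_eq_sum fun k hk => ?_
  have := digitalDigit_eq_zero (hC j) hn (by simpa using hk)
  rw [digitalDigit] at this
  rw [this]
  simp

theorem digit_add_mul {m i : ℕ} (q l : ℕ) (hl : l < m) :
    (q * 2 ^ m + i) / 2 ^ l % 2 = i / 2 ^ l % 2 := by
  obtain ⟨e, rfl⟩ : ∃ e, m = l + (e + 1) := ⟨m - l - 1, by omega⟩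
  have : q * 2 ^ (l + (e + 1)) + i = i + 2 ^ l * (q * 2 ^ e * 2) := by ring
  rw [this, Nat.add_mul_div_left _ _ (by positivity)]
  omega

theorem digit_add_mul_of_le {m i : ℕ} (hi : i < 2 ^ m) (q l : ℕ) (hl : m ≤ l) :
    (q * 2 ^ m + i) / 2 ^ l = q / 2 ^ (l - m) := by
  obtain ⟨e, rfl⟩ : ∃ e, l = m + e := ⟨l - m, by omega⟩
  rw [pow_add, ← Nat.div_div_eq_div_mul, mul_comm q, Nat.mul_add_div (by positivity),
    Nat.div_eq_of_lt hi]
  simp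

/-- On an aligned block of `2 ^ m` indices the digits are affine functions of the `m` lowest binary
digits of the index. -/
theorem exists_digitalEntry_block (C : Matrix ℕ ℕ (ZMod 2)) (m q : ℕ) :
    ∃ v : ℕ → ZMod 2, ∀ i < 2 ^ m, ∀ k, digitalEntry C (q * 2 ^ m + i) k =
      ∑ l : Fin m, C k l * ((i / 2 ^ (l : ℕ) % 2 : ℕ) : ZMod 2) + v k := by
  obtain ⟨W, hW⟩ : ∃ W, q < 2 ^ W := ⟨q, Nat.lt_two_pow_self⟩
  refine ⟨fun k => ∑ l ∈ range W, C k (m + l) * ((q / 2 ^ l % 2 : ℕ) : ZMod 2),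
    fun i hi k => ?_⟩
  have hlt : q * 2 ^ m + i < 2 ^ (m + W) := by
    rw [pow_add]
    calc q * 2 ^ m + i < q * 2 ^ m + 2 ^ m := by omega
      _ = 2 ^ m * (q + 1) := by ring
      _ ≤ 2 ^ m * 2 ^ W := Nat.mul_le_mul_left _ hW
  rw [digitalEntry_eq_sum_range C hlt, Finset.sum_range_add,
    Fin.sum_univ_eq_sum_range (fun l => C k l * ((i / 2 ^ l % 2 : ℕ) : ZMod 2))]
  congr 1
  · refine Finset.sum_congr rfl fun l hl => ?_
    rw [digit_add_mul q l (mem_range.1 hl)]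
  · refine Finset.sum_congr rfl fun l _ => ?_
    rw [digit_add_mul_of_le hi q (m + l) (Nat.le_add_right _ _), Nat.add_sub_cancel_left]

/-- Independent rows make the map surjective, and all fibres of a surjective homomorphism have the
same size. -/
theorem card_mulVec_eq {ρ : Type*} [Fintype ρ] [DecidableEq ρ] {m : ℕ}
    (A : Matrix ρ (Fin m) (ZMod 2)) (hA : LinearIndependent (ZMod 2) A.row) (v : ρ → ZMod 2) :
    (univ.filter fun x : Fin m → ZMod 2 => A.mulVec x = v).card * 2 ^ Fintype.card ρ = 2 ^ m := by
  have hsurj : Function.Surjective A.mulVecLin := by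
    rw [← LinearMap.range_eq_top]
    apply Submodule.eq_top_of_finrank_eq
    have := hA.rank_matrix
    rw [Matrix.rank] at this
    rw [this, Module.finrank_fintype_fun_eq_card]
  have hf : ∀ u : ρ → ZMod 2, (univ.filter fun x : Fin m → ZMod 2 => A.mulVec x = u).card =
      (univ.filter fun x : Fin m → ZMod 2 => A.mulVec x = v).card := fun u =>
    AddMonoidHom.card_fiber_eq_of_mem_range A.mulVecLin (hsurj u) (hsurj v)
  have hc := Finset.card_eq_sum_card_fiberwise (s := (univ : Finset (Fin m → ZMod 2)))
    (t := (univ : Finset (ρ → ZMod 2))) (f := A.mulVec) (fun _ _ => by simp)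
  simp only [hf, Finset.sum_const, Finset.card_univ, smul_eq_mul] at hc
  simp only [Fintype.card_fun, ZMod.card, Fintype.card_fin] at hc
  rw [hc, mul_comm]

theorem card_rows {s m : ℕ} {d : Fin s → ℕ} (hd : ∀ j, d j ≤ m) :
    Fintype.card {i : Fin s × Fin m // (i.2 : ℕ) < d i.1} = ∑ j, d j := by
  rw [Fintype.card_subtype, ← Finset.univ_product_univ, Finset.card_filter, Finset.sum_product]
  refine Finset.sum_congr rfl fun j _ => ?_
  rw [Fin.sum_univ_eq_sum_range (fun k => if k < d j then 1 else 0), ← Finset.card_filter]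
  have : (range m).filter (fun k => k < d j) = range (d j) := by
    ext k; simp only [mem_filter, mem_range]; have := hd j; omega
  rw [this, card_range]

/-- The definition covers only row counts with sum exactly `m - t`. Enlarging one of them, which
needs `s ≥ 1`, reaches that sum, and subfamilies of independent families are independent. -/
theorem GeneratesDigitalNet.linearIndependent_of_le {s t m : ℕ} (hs : 1 ≤ s)
    {C : Fin s → Matrix (Fin m) (Fin m) (ZMod 2)} (hC : GeneratesDigitalNet t m C)
    {d : Fin s → ℕ} (hd : ∑ j, d j ≤ m - t) :
    LinearIndependent (ZMod 2)
      (fun i : {i : Fin s × Fin m // (i.2 : ℕ) < d i.1} => C i.1.1 i.1.2) := by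
  obtain ⟨htm, hC⟩ := hC
  let j₀ : Fin s := ⟨0, hs⟩
  let d' := Function.update d j₀ (d j₀ + (m - t - ∑ j, d j))
  have hdd : ∀ j, d j ≤ d' j := by
    intro j
    by_cases h : j = j₀
    · rw [h]; simp [d']
    · simp [d', h]
  have hsum : ∑ j, d' j + t = m := by
    simp only [d']
    rw [Finset.sum_update_of_mem (mem_univ j₀)]
    rw [Finset.sum_eq_add_sum_sdiff_singleton_of_mem (mem_univ j₀) d] at hd ⊢
    omega
  exact (hC d' hsum).comp
    (fun i : {i : Fin s × Fin m // (i.2 : ℕ) < d i.1} =>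
      (⟨i.1, i.2.trans_le (hdd _)⟩ : {i : Fin s × Fin m // (i.2 : ℕ) < d' i.1}))
    (fun x y h => Subtype.ext (congrArg Subtype.val h :))

/-- The cell of the grid with mesh `2 ^ (-K)` that contains the `n`-th point. -/
def pointCell {s : ℕ} (C : Fin s → Matrix ℕ ℕ (ZMod 2)) (K n : ℕ) : Fin s → ℕ :=
  fun j => binVal (digitalDigit (C j) n) K

open Classical in
/-- Every aligned block of `2 ^ m` points has the right number of points in elementary boxes of
order at most `m - t`. -/
theorem card_block_elementary {s t : ℕ} (hs : 1 ≤ s) {C : Fin s → Matrix ℕ ℕ (ZMod 2)}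
    (hC : GeneratesDigitalSequence t C) {m K : ℕ} (hm : 1 ≤ m) (htm : t ≤ m) (hmK : m ≤ K) (q : ℕ)
    {d c : Fin s → ℕ} (hd : ∑ j, d j ≤ m - t) (hc : ∀ j, c j < 2 ^ d j) :
    (∑ i : Fin (2 ^ m), if ∀ j, pointCell C K (q * 2 ^ m + i) j / 2 ^ (K - d j) = c j
      then (1 : ℝ) else 0) = 2 ^ (m - ∑ j, d j) := by
  have hdm : ∀ j, d j ≤ m := fun j =>
    ((Finset.single_le_sum (fun _ _ => Nat.zero_le _) (mem_univ j)).trans hd).trans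
      (Nat.sub_le _ _)
  choose v hv using fun j => exists_digitalEntry_block (C j) m q
  let A : Matrix {i : Fin s × Fin m // (i.2 : ℕ) < d i.1} (Fin m) (ZMod 2) :=
    fun i l => C i.1.1 i.1.2 l
  -- The digits prescribed by the box, minus the constant part contributed by the high digits of the
  -- index.
  let u : {i : Fin s × Fin m // (i.2 : ℕ) < d i.1} → ZMod 2 := fun i =>
    ((c i.1.1 / 2 ^ (d i.1.1 - 1 - i.1.2) % 2 : ℕ) : ZMod 2) - v i.1.1 i.1.2
  have hA : LinearIndependent (ZMod 2) A.row :=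
    (hC.2 m hm htm).linearIndependent_of_le hs hd
  have hiff : ∀ i : Fin (2 ^ m),
      (∀ j, pointCell C K (q * 2 ^ m + i) j / 2 ^ (K - d j) = c j) ↔
        A.mulVec (finFunctionFinEquiv.symm i : Fin m → Fin 2) = u := by
    intro i
    have h1 : ∀ j, pointCell C K (q * 2 ^ m + i) j / 2 ^ (K - d j) = c j ↔
        ∀ k < d j, digitalEntry (C j) (q * 2 ^ m + i) k =
          ((c j / 2 ^ (d j - 1 - k) % 2 : ℕ) : ZMod 2) := by
      intro j
      rw [pointCell, binVal_div (digitalDigit_lt _ _) ((hdm j).trans hmK),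
        binVal_eq_iff (digitalDigit_lt _ _) _ _ (hc j)]
      refine forall₂_congr fun k _ => ?_
      rw [digitalDigit]
      constructor
      · intro h
        rw [← h, ZMod.natCast_val, ZMod.cast_id]
      · intro h
        rw [h, ZMod.val_natCast, Nat.mod_mod]
    have h2 : ∀ l : Fin m, ((i / 2 ^ (l : ℕ) % 2 : ℕ) : ZMod 2) =
        (finFunctionFinEquiv.symm i : Fin m → Fin 2) l := by
      intro l
      apply ZMod.val_injective
      rw [ZMod.val_natCast, Nat.mod_mod]
      exact (finFunctionFinEquiv_symm_apply_val i l).symm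
    simp only [h1]
    constructor
    · intro h
      funext r
      have := h r.1.1 r.1.2 r.2
      rw [hv _ _ i.2, ← eq_sub_iff_add_eq] at this
      simp only [h2] at this
      exact this
    · intro h j k hk
      have := congrFun h ⟨(j, ⟨k, hk.trans_le (hdm j)⟩), hk⟩
      rw [hv _ _ i.2, ← eq_sub_iff_add_eq]
      simp only [h2]
      exact this
  simp only [hiff]
  -- Indices in the block are replaced by their bit vectors, least significant bit first; `ZMod 2`
  -- unfolds to `Fin 2`.
  refine (Fintype.sum_equiv (finFunctionFinEquiv (m := 2) (n := m)).symm _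
    (fun x : Fin m → ZMod 2 => if A.mulVec x = u then (1 : ℝ) else 0) (fun _ => rfl)).trans ?_
  change (∑ x : Fin m → ZMod 2, if A.mulVec x = u then (1 : ℝ) else 0) = _
  rw [Finset.sum_boole]
  have hcard := card_mulVec_eq A hA u
  rw [card_rows hdm] at hcard
  have hle : ∑ j, d j ≤ m := hd.trans (Nat.sub_le _ _)
  have : (univ.filter fun x : Fin m → ZMod 2 => A.mulVec x = u).card = 2 ^ (m - ∑ j, d j) := by
    apply Nat.eq_of_mul_eq_mul_right (show 0 < 2 ^ ∑ j, d j by positivity)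
    rw [hcard, ← pow_add, Nat.sub_add_cancel hle]
  exact_mod_cast this

end HatQMC

/-! ### Discrepancy of the first `n` points -/

namespace HatQMC

open Finset

theorem sum_fin_div_two_pow_eq {K d c : ℕ} (hd : d ≤ K) (hc : c < 2 ^ d) :
    (∑ l : Fin (2 ^ K), if (l : ℕ) / 2 ^ (K - d) = c then (1 : ℝ) else 0) = 2 ^ (K - d) := by
  rw [Fin.sum_univ_eq_sum_range (fun l => if l / 2 ^ (K - d) = c then (1 : ℝ) else 0),
    Finset.sum_boole]
  have h : (range (2 ^ K)).filter (fun l => l / 2 ^ (K - d) = c) =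
      Finset.Ico (c * 2 ^ (K - d)) ((c + 1) * 2 ^ (K - d)) := by
    ext l
    have hpos : 0 < 2 ^ (K - d) := by positivity
    have hK : 2 ^ K = 2 ^ d * 2 ^ (K - d) := by rw [← pow_add]; congr 1; omega
    rw [mem_filter, mem_range, Finset.mem_Ico, ← Nat.le_div_iff_mul_le hpos,
      ← Nat.div_lt_iff_lt_mul hpos, hK, ← Nat.div_lt_iff_lt_mul hpos]
    omega
  rw [h, Nat.card_Ico, ← Nat.sub_mul]
  simp

theorem sum_cells_elementary {s K : ℕ} {d c : Fin s → ℕ} (hd : ∀ j, d j ≤ K)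
    (hc : ∀ j, c j < 2 ^ d j) :
    (∑ l : Fin s → Fin (2 ^ K), if ∀ j, (l j : ℕ) / 2 ^ (K - d j) = c j then (1 : ℝ) else 0) *
      2 ^ ∑ j, d j = (2 ^ K) ^ s := by
  have h : ∀ l : Fin s → Fin (2 ^ K),
      (if ∀ j, (l j : ℕ) / 2 ^ (K - d j) = c j then (1 : ℝ) else 0) =
        ∏ j, if (l j : ℕ) / 2 ^ (K - d j) = c j then (1 : ℝ) else 0 := by
    intro l
    rw [Finset.prod_ite_zero]
    simp
  simp only [h]
  have h2 := Finset.prod_univ_sum (fun _ : Fin s => (univ : Finset (Fin (2 ^ K))))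
    (fun j l => if (l : ℕ) / 2 ^ (K - d j) = c j then (1 : ℝ) else 0)
  rw [Fintype.piFinset_univ] at h2
  rw [← h2, Finset.prod_congr rfl fun j _ => sum_fin_div_two_pow_eq (hd j) (hc j),
    ← Finset.prod_pow_eq_pow_sum, ← Finset.prod_mul_distrib]
  rw [Finset.prod_congr rfl (g := fun _ => (2 : ℝ) ^ K) fun j _ => by
    rw [← pow_add, Nat.sub_add_cancel (hd j)]]
  simp

theorem sum_cells_le {s K : ℕ} (p : (Fin s → Fin (2 ^ K)) → Prop) [DecidablePred p] :
    (∑ l, if p l then (1 : ℝ) else 0) ≤ (2 ^ K) ^ s := by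
  calc (∑ l, if p l then (1 : ℝ) else 0) ≤ ∑ _l : Fin s → Fin (2 ^ K), (1 : ℝ) :=
        Finset.sum_le_sum fun l _ => by split_ifs <;> norm_num
    _ = _ := by simp

theorem sum_boole_nonneg {α : Type*} (S : Finset α) (p : α → Prop) [DecidablePred p] :
    0 ≤ ∑ l ∈ S, if p l then (1 : ℝ) else 0 :=
  Finset.sum_nonneg fun l _ => by split_ifs <;> norm_num

-- For `m ≤ t` both counts lie in `[0, 2^m]`. For `m > t` the cutting lemma compares two weightings
-- of the disjoint union of points and grid cells: mass 1 on each point, and mass `2^m` spread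
-- evenly over the cells. It starts from the whole cube with `m - t` subdivisions. The bound uses
-- `M` instead of `m` so that it is common to all block sizes.
open Classical in
theorem abs_block_discrepancy_le {s t : ℕ} (hs : 1 ≤ s) {C : Fin s → Matrix ℕ ℕ (ZMod 2)}
    (hC : GeneratesDigitalSequence t C) {m K M : ℕ} (hmM : m ≤ M) (hmK : m ≤ K) (q : ℕ)
    {T : Finset (Fin s)} (hT : T.Nonempty) (Λ : Fin s → ℕ) :
    |(∑ i ∈ range (2 ^ m), if ∀ j ∈ T, pointCell C K (q * 2 ^ m + i) j < Λ j
        then (1 : ℝ) else 0) - 2 ^ m / (2 ^ K) ^ s *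
      ∑ l : Fin s → Fin (2 ^ K), if ∀ j ∈ T, (l j : ℕ) < Λ j then (1 : ℝ) else 0|
      ≤ 2 ^ t * (M + 1) ^ (T.card - 1) := by
  have hone : (1 : ℝ) ≤ ((M : ℝ) + 1) ^ (T.card - 1) :=
    one_le_pow₀ (by have := Nat.cast_nonneg (α := ℝ) M; linarith)
  have hR : (0 : ℝ) < (2 ^ K) ^ s := by positivity
  rcases le_or_gt m t with hmt | hmt
  · have h1 := sum_boole_nonneg (range (2 ^ m))
      (fun i => ∀ j ∈ T, pointCell C K (q * 2 ^ m + i) j < Λ j)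
    have h2 : (∑ i ∈ range (2 ^ m), if ∀ j ∈ T, pointCell C K (q * 2 ^ m + i) j < Λ j
        then (1 : ℝ) else 0) ≤ 2 ^ m := by
      calc _ ≤ ∑ i ∈ range (2 ^ m), (1 : ℝ) :=
            Finset.sum_le_sum fun i _ => by split_ifs <;> norm_num
        _ = _ := by simp
    have h3 := sum_boole_nonneg (univ : Finset (Fin s → Fin (2 ^ K)))
      (fun l => ∀ j ∈ T, (l j : ℕ) < Λ j)
    have h4 := sum_cells_le (K := K) (fun l : Fin s → Fin (2 ^ K) => ∀ j ∈ T, (l j : ℕ) < Λ j)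
    set c := ∑ l : Fin s → Fin (2 ^ K), if ∀ j ∈ T, (l j : ℕ) < Λ j then (1 : ℝ) else 0
    have h5 : (2 : ℝ) ^ m / (2 ^ K) ^ s * c ≤ 2 ^ m := by
      rw [div_mul_eq_mul_div, div_le_iff₀ hR]
      gcongr
    have h6 : (0 : ℝ) ≤ 2 ^ m / (2 ^ K) ^ s * c := by positivity
    have h7 : (2 : ℝ) ^ m ≤ 2 ^ t * ((M : ℝ) + 1) ^ (T.card - 1) :=
      (pow_le_pow_right₀ (by norm_num) hmt).trans (le_mul_of_one_le_right (by positivity) hone)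
    rw [abs_le]
    constructor <;> linarith
  · let L : Fin (2 ^ m) ⊕ (Fin s → Fin (2 ^ K)) → Fin s → ℕ :=
      Sum.elim (fun i => pointCell C K (q * 2 ^ m + i)) (fun l j => l j)
    let w₁ : Fin (2 ^ m) ⊕ (Fin s → Fin (2 ^ K)) → ℝ := Sum.elim (fun _ => 1) (fun _ => 0)
    let w₂ : Fin (2 ^ m) ⊕ (Fin s → Fin (2 ^ K)) → ℝ :=
      Sum.elim (fun _ => 0) (fun _ => 2 ^ m / (2 ^ K) ^ s)
    have hdK : ∀ d : Fin s → ℕ, ∑ j, d j ≤ m - t → ∀ j, d j ≤ K := fun d hd j =>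
      (Finset.single_le_sum (f := d) (fun _ _ => Nat.zero_le _) (mem_univ j)).trans (by omega)
    have hpow : ∀ d : Fin s → ℕ, ∑ j, d j ≤ m - t →
        (2 : ℝ) ^ (m - ∑ j, d j) = 2 ^ t * 2 ^ (m - t - ∑ j, d j) := fun d hd => by
      rw [← pow_add]; congr 1; omega
    have key := abs_sum_cut_le L w₁ w₂ (K := K) (k := m - t) (τ := 2 ^ t)
      (by rintro (i | l) <;> simp [w₁]) (by rintro (i | l) <;> simp only [w₂, Sum.elim_inl,
        Sum.elim_inr] <;> positivity) (by omega) (by positivity)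
      (fun d c hd hc => by
        refine (Fintype.sum_sum_type _).trans ?_
        change (∑ i : Fin (2 ^ m), if ∀ j, pointCell C K (q * 2 ^ m + i) j / 2 ^ (K - d j) = c j
          then (1 : ℝ) else 0) + (∑ l : Fin s → Fin (2 ^ K),
            if ∀ j, (l j : ℕ) / 2 ^ (K - d j) = c j then (0 : ℝ) else 0) = _
        simp only [ite_self, Finset.sum_const_zero, add_zero]
        rw [card_block_elementary hs hC (by omega) hmt.le hmK q hd hc, hpow d hd])
      (fun d c hd hc => by
        refine (Fintype.sum_sum_type _).trans ?_
        change (∑ i : Fin (2 ^ m), if ∀ j, pointCell C K (q * 2 ^ m + i) j / 2 ^ (K - d j) = c j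
          then (0 : ℝ) else 0) + (∑ l : Fin s → Fin (2 ^ K),
            if ∀ j, (l j : ℕ) / 2 ^ (K - d j) = c j then (2 : ℝ) ^ m / (2 ^ K) ^ s else 0) = _
        simp only [ite_self, Finset.sum_const_zero, zero_add]
        have h := sum_cells_elementary (hdK d hd) hc
        rw [← hpow d hd]
        have h2 : ∀ l : Fin s → Fin (2 ^ K), (if ∀ j, (l j : ℕ) / 2 ^ (K - d j) = c j
            then (2 : ℝ) ^ m / (2 ^ K) ^ s else 0) = 2 ^ m / (2 ^ K) ^ s *
            (if ∀ j, (l j : ℕ) / 2 ^ (K - d j) = c j then (1 : ℝ) else 0) := fun l => by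
          rw [mul_ite, mul_one, mul_zero]
        simp only [h2, ← Finset.mul_sum]
        rw [← h, div_mul_eq_mul_div, div_eq_iff (by rw [h]; positivity)]
        have h3 : (2 : ℝ) ^ m = 2 ^ (m - ∑ j, d j) * 2 ^ ∑ j, d j := by
          rw [← pow_add]; congr 1; omega
        rw [h3]; ring)
      T Λ (m - t) 0 0 (by simp) (by simp)
    have hzero : ∀ i, ∀ j, L i j / 2 ^ (K - (0 : Fin s → ℕ) j) = (0 : Fin s → ℕ) j := by
      rintro (i | l) j
      · exact Nat.div_eq_of_lt (binVal_lt (digitalDigit_lt _ _) K)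
      · exact Nat.div_eq_of_lt (l j).2
    simp only [hzero, implies_true, true_and] at key
    rw [Fintype.sum_sum_type] at key
    simp only [L, w₁, w₂, Sum.elim_inl, Sum.elim_inr, sub_zero, zero_sub] at key
    rw [Fin.sum_univ_eq_sum_range (fun i => if ∀ j ∈ T, pointCell C K (q * 2 ^ m + i) j < Λ j
        then (1 : ℝ) else 0)] at key
    have h2 : ∀ l : Fin s → Fin (2 ^ K), (if ∀ j ∈ T, (l j : ℕ) < Λ j
        then -((2 : ℝ) ^ m / (2 ^ K) ^ s) else 0) = -(2 ^ m / (2 ^ K) ^ s) *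
        (if ∀ j ∈ T, (l j : ℕ) < Λ j then (1 : ℝ) else 0) := fun l => by
      rw [mul_ite, mul_one, mul_zero]
    rw [Finset.sum_congr rfl fun l _ => h2 l, ← Finset.mul_sum, neg_mul, ← sub_eq_add_neg] at key
    refine key.trans ?_
    gcongr
    obtain ⟨r, hr⟩ : ∃ r, T.card = r + 1 := ⟨T.card - 1, by have := hT.card_pos; omega⟩
    rw [hr, Nat.add_sub_cancel]
    calc (cutCount (r + 1) (m - t) : ℝ) ≤ (((m - t) + 1) ^ r : ℕ) := by
          exact_mod_cast cutCount_succ_le r (m - t)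
      _ ≤ ((M + 1) ^ r : ℕ) := by
          exact_mod_cast Nat.pow_le_pow_left (by omega) r
      _ = _ := by push_cast; rfl

/-- The binary expansion of `n` cuts the segment into aligned blocks of decreasing length, at most
one of each length `2^m` with `m < M`. The offset `q` is needed because what remains after the first
block starts at an odd multiple of `2^M`. -/
theorem abs_sum_shift_le_of_blocks (g : ℕ → ℝ) (c B : ℝ) (hB : 0 ≤ B) (M : ℕ)
    (h : ∀ m < M, ∀ q, |(∑ i ∈ range (2 ^ m), g (q * 2 ^ m + i)) - 2 ^ m * c| ≤ B) :
    ∀ n q, n < 2 ^ M → |(∑ i ∈ range n, g (q * 2 ^ M + i)) - n * c| ≤ M * B := by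
  induction M with
  | zero =>
    intro n q hn
    have : n = 0 := by simpa using hn
    subst this; simp
  | succ M ih =>
    intro n q hn
    have ih' := ih fun m hm => h m (hm.trans (Nat.lt_succ_self M))
    rw [pow_succ] at hn
    have e0 : q * 2 ^ (M + 1) = 2 * q * 2 ^ M := by ring
    rw [e0]
    rcases lt_or_ge n (2 ^ M) with hlt | hge
    · refine (ih' n (2 * q) hlt).trans ?_
      push_cast
      linarith
    · obtain ⟨n', rfl⟩ : ∃ n', n = 2 ^ M + n' := ⟨n - 2 ^ M, by omega⟩
      rw [Finset.sum_range_add]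
      have e1 : ∀ i, 2 * q * 2 ^ M + (2 ^ M + i) = (2 * q + 1) * 2 ^ M + i := fun i => by ring
      simp only [e1]
      have h1 := h M (Nat.lt_succ_self M) (2 * q)
      have h2 := ih' n' (2 * q + 1) (by omega)
      rw [abs_le] at h1 h2 ⊢
      push_cast
      constructor <;> linarith [h1.1, h1.2, h2.1, h2.2]

open Classical in
/-- A discrepancy estimate for the first `n` points of a digital sequence, in terms of the cells of
a fine dyadic grid. -/
theorem abs_discrepancy_le {s t : ℕ} (hs : 1 ≤ s) {C : Fin s → Matrix ℕ ℕ (ZMod 2)}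
    (hC : GeneratesDigitalSequence t C) {n K M : ℕ} (hn : n < 2 ^ (M + 1)) (hMK : M ≤ K)
    {T : Finset (Fin s)} (hT : T.Nonempty) (Λ : Fin s → ℕ) :
    |(∑ i ∈ range n, if ∀ j ∈ T, pointCell C K i j < Λ j then (1 : ℝ) else 0) -
      n / (2 ^ K) ^ s *
      ∑ l : Fin s → Fin (2 ^ K), if ∀ j ∈ T, (l j : ℕ) < Λ j then (1 : ℝ) else 0|
      ≤ 2 ^ t * (M + 1) ^ T.card := by
  have h := abs_sum_shift_le_of_blocks
    (fun i => if ∀ j ∈ T, pointCell C K i j < Λ j then (1 : ℝ) else 0)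
    (1 / (2 ^ K) ^ s *
      ∑ l : Fin s → Fin (2 ^ K), if ∀ j ∈ T, (l j : ℕ) < Λ j then (1 : ℝ) else 0)
    (2 ^ t * (M + 1) ^ (T.card - 1)) (by positivity) (M + 1) (fun m hm q => by
      have := abs_block_discrepancy_le hs hC (Nat.lt_succ_iff.1 hm)
        ((Nat.lt_succ_iff.1 hm).trans hMK) q hT Λ
      rw [div_eq_mul_one_div, mul_assoc] at this
      exact this) n 0 hn
  simp only [zero_mul, zero_add] at h
  rw [← mul_assoc, mul_one_div] at h
  refine h.trans (le_of_eq ?_)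
  obtain ⟨r, hr⟩ : ∃ r, T.card = r + 1 := ⟨T.card - 1, by have := hT.card_pos; omega⟩
  rw [hr, Nat.add_sub_cancel]
  push_cast
  ring

end HatQMC

/-! ### Inverse distribution functions and grid averages -/

namespace HatQMC

open Set Finset MeasureTheory

theorem abs_update_sub_le {s : ℕ} {a b : Fin s → ℝ} {f : (Fin s → ℝ) → ℝ}
    (hf : HasMixedPartials a b f) {M : Finset (Fin s) → ℝ}
    (hM : ∀ u, ∀ x ∈ Icc a b, |mixedPartial a b f u x| ≤ M u) {x : Fin s → ℝ}
    (hx : x ∈ Icc a b) (j : Fin s) {y : ℝ} (hy : y ∈ Icc (a j) (b j)) :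
    |f (Function.update x j y) - f x| ≤ M {j} * |y - x j| := by
  have h := (convex_Icc (a j) (b j)).norm_image_sub_le_of_norm_derivWithin_le
    (f := fun y => f (Function.update x j y)) (C := M {j}) (x := x j) (y := y)
    (by simpa [mixedPartial_empty] using
      hf.differentiableOn (u := ∅) (j := j) (by simp) hx)
    (fun z hz => by
      have h1 := hM {j} _ (update_mem_Icc hx hz)
      rw [← insert_empty_eq, mixedPartial_insert a b f (by simp), boxPartial_update,
        mixedPartial_empty, insert_empty_eq] at h1
      exact h1)
    ⟨hx.1 j, hx.2 j⟩ hy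
  simpa using h

/-- A function with bounded mixed partial derivatives is Lipschitz in every coordinate. -/
theorem abs_sub_le_sum {s : ℕ} {a b : Fin s → ℝ} {f : (Fin s → ℝ) → ℝ}
    (hf : HasMixedPartials a b f) {M : Finset (Fin s) → ℝ}
    (hM : ∀ u, ∀ x ∈ Icc a b, |mixedPartial a b f u x| ≤ M u) {x y : Fin s → ℝ}
    (hx : x ∈ Icc a b) (hy : y ∈ Icc a b) : |f x - f y| ≤ ∑ j, M {j} * |x j - y j| := by
  have key : ∀ S : Finset (Fin s), S.piecewise x y ∈ Icc a b ∧
      |f (S.piecewise x y) - f y| ≤ ∑ j ∈ S, M {j} * |x j - y j| := by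
    intro S
    induction S using Finset.induction with
    | empty => simpa using hy
    | insert j S hj ih =>
      rw [Finset.piecewise_insert, Finset.sum_insert hj]
      have hxj : x j ∈ Icc (a j) (b j) := ⟨hx.1 j, hx.2 j⟩
      refine ⟨update_mem_Icc ih.1 hxj, ?_⟩
      have h := abs_update_sub_le hf hM ih.1 j hxj
      rw [Finset.piecewise_eq_of_notMem _ _ _ hj] at h
      exact (abs_sub_le _ _ _).trans (add_le_add h ih.2)
  simpa using (key Finset.univ).2

theorem continuousOn_of_mixedPartials {s : ℕ} {a b : Fin s → ℝ} {f : (Fin s → ℝ) → ℝ}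
    (hf : HasMixedPartials a b f) {M : Finset (Fin s) → ℝ}
    (hM : ∀ u, ∀ x ∈ Icc a b, |mixedPartial a b f u x| ≤ M u) : ContinuousOn f (Icc a b) := by
  intro x hx
  rw [ContinuousWithinAt, tendsto_iff_norm_sub_tendsto_zero]
  have hc : Filter.Tendsto (fun y : Fin s → ℝ => ∑ j, M {j} * |y j - x j|) (nhdsWithin x (Icc a b))
      (nhds 0) := by
    have : Continuous fun y : Fin s → ℝ => ∑ j, M {j} * |y j - x j| := by fun_prop
    simpa using (this.tendsto x).mono_left nhdsWithin_le_nhds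
  refine squeeze_zero' (Filter.Eventually.of_forall fun _ => norm_nonneg _) ?_ hc
  filter_upwards [self_mem_nhdsWithin] with y hy
  exact abs_sub_le_sum hf hM hy hx

/-- `φ` is a continuous probability density on `[A, B]`, and `ψ` is a right inverse of its
distribution function. -/
structure IsInvCDF (A B : ℝ) (φ ψ : ℝ → ℝ) : Prop where
  lt : A < B
  cont : Continuous φ
  nonneg : ∀ x, 0 ≤ φ x
  mass : ∫ x in A..B, φ x = 1
  mem : ∀ z ∈ Icc (0 : ℝ) 1, ψ z ∈ Icc A B
  cdf : ∀ z ∈ Icc (0 : ℝ) 1, ∫ x in A..ψ z, φ x = z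

namespace IsInvCDF

variable {A B : ℝ} {φ ψ : ℝ → ℝ}

theorem integral_le (h : IsInvCDF A B φ ψ) {x y : ℝ} (hxy : x ≤ y) :
    ∫ t in A..x, φ t ≤ ∫ t in A..y, φ t := by
  have h1 := intervalIntegral.integral_add_adjacent_intervals (μ := volume)
    (h.cont.intervalIntegrable A x) (h.cont.intervalIntegrable x y)
  have h2 : 0 ≤ ∫ t in x..y, φ t :=
    intervalIntegral.integral_nonneg hxy fun t _ => h.nonneg t
  linarith

theorem lt_of_integral_lt (h : IsInvCDF A B φ ψ) {x y : ℝ}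
    (hxy : ∫ t in A..x, φ t < ∫ t in A..y, φ t) : x < y :=
  lt_of_not_ge fun hyx => absurd (h.integral_le hyx) (not_le.2 hxy)

/-- Although `ψ` is only a right inverse, it is increasing because the distribution function is
monotone and takes the values `z < z'` at `ψ z` and `ψ z'`. -/
theorem strictMonoOn (h : IsInvCDF A B φ ψ) : StrictMonoOn ψ (Icc 0 1) := fun z hz z' hz' hzz =>
  h.lt_of_integral_lt (by rwa [h.cdf z hz, h.cdf z' hz'])

end IsInvCDF

/-- The end points of a partition of `[A, B]` into `R` intervals. -/
noncomputable def partPoint (A B : ℝ) (ψ : ℝ → ℝ) (R l : ℕ) : ℝ :=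
  if l = 0 then A else if l < R then ψ (l / R) else B

theorem div_mem_unit {l R : ℕ} (h : l ≤ R) : (l / R : ℝ) ∈ Icc (0 : ℝ) 1 :=
  ⟨by positivity, div_le_one_of_le₀ (by exact_mod_cast h) (by positivity)⟩

namespace IsInvCDF

variable {A B : ℝ} {φ ψ : ℝ → ℝ}

theorem partPoint_mem (h : IsInvCDF A B φ ψ) (R l : ℕ) : partPoint A B ψ R l ∈ Icc A B := by
  unfold partPoint
  split_ifs with h1 h2
  · exact ⟨le_rfl, h.lt.le⟩
  · exact h.mem _ (div_mem_unit h2.le)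
  · exact ⟨h.lt.le, le_rfl⟩

theorem partPoint_monotone (h : IsInvCDF A B φ ψ) (R : ℕ) : Monotone (partPoint A B ψ R) := by
  intro l l' hl
  by_cases h0 : l = 0
  · have : partPoint A B ψ R l = A := by simp [partPoint, h0]
    rw [this]
    exact (h.partPoint_mem R l').1
  by_cases h1 : l' < R
  · have h0' : l' ≠ 0 := by omega
    have h1' : l < R := by omega
    simp only [partPoint, h0, h0', h1, h1', if_true, if_false]
    refine h.strictMonoOn.monotoneOn (div_mem_unit h1'.le) (div_mem_unit h1.le) ?_
    gcongr
  · have h0' : l' ≠ 0 := by omega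
    have : partPoint A B ψ R l' = B := by simp [partPoint, h0', h1]
    rw [this]
    exact (h.partPoint_mem R l).2

theorem integral_partPoint (h : IsInvCDF A B φ ψ) {R l : ℕ} (hR : 0 < R) (hl : l ≤ R) :
    ∫ x in A..partPoint A B ψ R l, φ x = l / R := by
  unfold partPoint
  split_ifs with h1 h2
  · simp [h1]
  · exact h.cdf _ (div_mem_unit hl)
  · have : l = R := by omega
    rw [h.mass, this, div_self (by positivity)]

theorem setIntegral_part (h : IsInvCDF A B φ ψ) {R l : ℕ} (hR : 0 < R) (hl : l < R) :
    ∫ x in Ioc (partPoint A B ψ R l) (partPoint A B ψ R (l + 1)), φ x = 1 / R := by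
  rw [← intervalIntegral.integral_of_le (h.partPoint_monotone R (Nat.le_succ l))]
  have h1 := intervalIntegral.integral_add_adjacent_intervals (μ := volume)
    (h.cont.intervalIntegrable A (partPoint A B ψ R l))
    (h.cont.intervalIntegrable (partPoint A B ψ R l) (partPoint A B ψ R (l + 1)))
  rw [h.integral_partPoint hR hl.le, h.integral_partPoint hR hl] at h1
  push_cast at h1
  rw [add_div] at h1
  linarith

/-- The node of every cell but the first is its left end point. The first cell starts at `A`,
whereas `ψ 0` may lie further right where the density vanishes near `A`, so the full length `B - A`
is allowed there. -/
theorem abs_sub_node_le (h : IsInvCDF A B φ ψ) {R l : ℕ} (hl : l < R) {x : ℝ}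
    (hx : x ∈ Ioc (partPoint A B ψ R l) (partPoint A B ψ R (l + 1))) :
    |x - ψ (l / R)| ≤ (if l = 0 then B - A else 0) +
      (partPoint A B ψ R (l + 1) - partPoint A B ψ R l) := by
  have hm := h.mem _ (div_mem_unit hl.le)
  have h1 := h.partPoint_mem R l
  have h2 := h.partPoint_mem R (l + 1)
  rw [abs_le]
  by_cases h0 : l = 0
  · simp only [h0, if_true]
    rw [h0] at hx h1 h2 hm
    constructor <;> linarith [hx.1, hx.2, hm.1, hm.2, h1.1, h1.2, h2.1, h2.2]
  · have : partPoint A B ψ R l = ψ (l / R) := by simp [partPoint, h0, hl]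
    simp only [h0, if_false, ← this]
    constructor <;> linarith [hx.1, hx.2]

theorem sum_width (_ : IsInvCDF A B φ ψ) {R : ℕ} (hR : 0 < R) :
    ∑ l : Fin R, ((if (l : ℕ) = 0 then B - A else 0) +
      (partPoint A B ψ R (l + 1) - partPoint A B ψ R l)) = 2 * (B - A) := by
  rw [Fin.sum_univ_eq_sum_range (fun l => (if l = 0 then B - A else 0) +
      (partPoint A B ψ R (l + 1) - partPoint A B ψ R l)), Finset.sum_add_distrib,
    Finset.sum_range_sub, Finset.sum_ite_eq' (range R) 0]
  have : partPoint A B ψ R R = B := by simp [partPoint, hR.ne']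
  simp only [Finset.mem_range, hR, if_true, this]
  simp [partPoint]
  ring

theorem iUnion_part (h : IsInvCDF A B φ ψ) {R : ℕ} (hR : 0 < R) :
    ⋃ l : Fin R, Ioc (partPoint A B ψ R l) (partPoint A B ψ R (l + 1)) = Ioc A B := by
  have h1 := (h.partPoint_monotone R).biUnion_Ico_Ioc_map_succ 0 R
  have h2 : partPoint A B ψ R 0 = A := by simp [partPoint]
  have h3 : partPoint A B ψ R R = B := by simp [partPoint, hR.ne']
  rw [h2, h3] at h1
  rw [← h1]
  ext x
  simp only [mem_iUnion, Order.succ_eq_add_one, exists_prop, Set.mem_Ico, Nat.zero_le, true_and]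
  constructor
  · rintro ⟨l, hl⟩
    exact ⟨l, l.2, hl⟩
  · rintro ⟨l, hlR, hl⟩
    exact ⟨⟨l, hlR⟩, hl⟩

end IsInvCDF

theorem sum_apply_div_pow {s R : ℕ} (hR : 0 < R) (j : Fin s) (g : Fin R → ℝ) :
    (∑ l : Fin s → Fin R, g (l j)) / (R : ℝ) ^ s = (∑ l, g l) / R := by
  have h2 := Finset.prod_univ_sum (fun _ : Fin s => (Finset.univ : Finset (Fin R)))
    (fun i l => if i = j then g l else 1)
  rw [Fintype.piFinset_univ] at h2
  simp only [Finset.prod_ite_eq', Finset.mem_univ, if_true] at h2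
  rw [← h2, show (R : ℝ) ^ s = ∏ _i : Fin s, (R : ℝ) by simp, ← Finset.prod_div_distrib,
    Finset.prod_eq_single j]
  · simp
  · intro i _ hi
    simp only [hi, if_false, Finset.sum_const, Finset.card_univ, Fintype.card_fin, nsmul_eq_mul,
      mul_one]
    exact div_self (by positivity)
  · simp

/-- Integration against a product density is approximated by the average over the images of the
nodes of an equidistant grid. -/
theorem abs_integral_sub_average_le {s : ℕ} {a b : Fin s → ℝ} {φ ψ : Fin s → ℝ → ℝ}
    (h : ∀ j, IsInvCDF (a j) (b j) (φ j) (ψ j)) {f : (Fin s → ℝ) → ℝ} {c : Fin s → ℝ}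
    (hc : ∀ j, 0 ≤ c j) (hf : ContinuousOn f (Icc a b))
    (hfc : ∀ x ∈ Icc a b, ∀ y ∈ Icc a b, |f x - f y| ≤ ∑ j, c j * |x j - y j|) {R : ℕ}
    (hR : 0 < R) :
    |(∫ x in Icc a b, f x * ∏ j, φ j (x j)) -
      (∑ l : Fin s → Fin R, f (fun j => ψ j (l j / R))) / (R : ℝ) ^ s| ≤
      (∑ j, c j * (2 * (b j - a j))) / R := by
  set e : Fin s → ℕ → ℝ := fun j => partPoint (a j) (b j) (ψ j) R with he
  set cell : (Fin s → Fin R) → Set (Fin s → ℝ) := fun l =>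
    Set.univ.pi fun j => Ioc (e j (l j)) (e j (l j + 1)) with hcell
  set W : Fin s → Fin R → ℝ := fun j l => (if (l : ℕ) = 0 then b j - a j else 0) +
    (e j (l + 1) - e j l) with hW
  have hφc : Continuous fun x : Fin s → ℝ => ∏ j, φ j (x j) :=
    continuous_finsetProd _ fun j _ => (h j).cont.comp (continuous_apply j)
  have hφ0 : ∀ x : Fin s → ℝ, 0 ≤ ∏ j, φ j (x j) := fun x =>
    Finset.prod_nonneg fun j _ => (h j).nonneg _
  have hsub : ∀ l, cell l ⊆ Icc a b := by
    intro l x hx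
    rw [← Set.pi_univ_Icc]
    intro j _
    have := hx j trivial
    exact ⟨((h j).partPoint_mem R _).1.trans this.1.le, this.2.trans ((h j).partPoint_mem R _).2⟩
  have hmeas : ∀ l, MeasurableSet (cell l) := fun l =>
    MeasurableSet.univ_pi fun j => measurableSet_Ioc
  have hint : IntegrableOn (fun x => f x * ∏ j, φ j (x j)) (Icc a b) :=
    (hf.mul hφc.continuousOn).integrableOn_compact isCompact_Icc
  have hunion : ⋃ l, cell l = Set.univ.pi fun j => Ioc (a j) (b j) := by
    rw [hcell, Set.iUnion_univ_pi (fun j (l : Fin R) => Ioc (e j l) (e j (l + 1)))]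
    simp only [he, fun j => (h j).iUnion_part hR]
  have hdisj : Pairwise (Function.onFun Disjoint cell) := by
    intro l l' hll
    obtain ⟨j, hj⟩ := Function.ne_iff.1 hll
    refine Set.disjoint_left.2 fun x hx hx' => ?_
    have h1 := ((h j).partPoint_monotone R).pairwise_disjoint_on_Ioc_succ
      (fun hh => hj (Fin.ext hh) : (l j : ℕ) ≠ l' j)
    exact Set.disjoint_left.1 h1 (hx j trivial) (hx' j trivial)
  -- The cells are cut at quantiles, so all have equal mass and the plain average over the nodes is
  -- a Riemann sum.
  have hmass : ∀ l, ∫ x in cell l, ∏ j, φ j (x j) = 1 / (R : ℝ) ^ s := by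
    intro l
    rw [hcell, volume_pi, Measure.restrict_pi_pi, integral_fintype_prod_eq_prod
      (f := fun j x => φ j x), Finset.prod_congr rfl fun j _ =>
      (h j).setIntegral_part hR (l j).2]
    simp
  have hsplit : ∫ x in Icc a b, f x * ∏ j, φ j (x j) =
      ∑ l, ∫ x in cell l, f x * ∏ j, φ j (x j) := by
    rw [← integral_iUnion_fintype hmeas hdisj fun l => hint.mono_set (hsub l), hunion]
    exact (setIntegral_congr_set Measure.univ_pi_Ioc_ae_eq_Icc).symm
  have hcellest : ∀ l : Fin s → Fin R,
      |(∫ x in cell l, f x * ∏ j, φ j (x j)) - f (fun j => ψ j (l j / R)) / (R : ℝ) ^ s| ≤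
        (∑ j, c j * W j (l j)) / (R : ℝ) ^ s := by
    intro l
    have hX : (fun j => ψ j (l j / R)) ∈ Icc a b := by
      rw [← Set.pi_univ_Icc]
      exact fun j _ => (h j).mem _ (div_mem_unit (l j).2.le)
    have hφi : IntegrableOn (fun x : Fin s → ℝ => ∏ j, φ j (x j)) (cell l) :=
      (hφc.continuousOn.integrableOn_compact isCompact_Icc).mono_set (hsub l)
    have e1 : (∫ x in cell l, f x * ∏ j, φ j (x j)) - f (fun j => ψ j (l j / R)) / (R : ℝ) ^ s =
        ∫ x in cell l, (f x - f (fun j => ψ j (l j / R))) * ∏ j, φ j (x j) := by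
      simp only [sub_mul]
      rw [integral_sub (hint.mono_set (hsub l)) (hφi.const_mul _), integral_const_mul, hmass]
      ring
    have e2 : (∑ j, c j * W j (l j)) / (R : ℝ) ^ s =
        ∫ x in cell l, (∑ j, c j * W j (l j)) * ∏ j, φ j (x j) := by
      rw [integral_const_mul, hmass]; ring
    rw [e1, e2, ← Real.norm_eq_abs]
    refine norm_integral_le_of_norm_le (hφi.const_mul _) ?_
    filter_upwards [ae_restrict_mem (hmeas l)] with x hx
    rw [norm_mul, Real.norm_of_nonneg (hφ0 x)]
    refine mul_le_mul_of_nonneg_right ((hfc x (hsub l hx) _ hX).trans ?_) (hφ0 x)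
    exact Finset.sum_le_sum fun j _ => mul_le_mul_of_nonneg_left
      ((h j).abs_sub_node_le (l j).2 (hx j trivial)) (hc j)
  rw [hsplit, Finset.sum_div, ← Finset.sum_sub_distrib]
  refine (Finset.abs_sum_le_sum_abs _ _).trans ((Finset.sum_le_sum fun l _ => hcellest l).trans
    (le_of_eq ?_))
  -- Each width depends on one coordinate only, so its grid average is the one-dimensional sum of
  -- widths, `2 (b j - a j)`, divided by `R`.
  rw [← Finset.sum_div, Finset.sum_comm, Finset.sum_div, Finset.sum_div]
  refine Finset.sum_congr rfl fun j _ => ?_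
  rw [sum_apply_div_pow hR j (fun l => c j * W j l), ← Finset.mul_sum]
  congr 2
  exact (h j).sum_width hR

end HatQMC

/-! ### The transported quasi-Monte Carlo rule -/

namespace HatQMC

open Set Finset MeasureTheory

/-- By monotonicity of `ψ` the nodes mapped below `y` form an initial segment. This turns real boxes
in `[a, b]` into the integer cuts of the discrepancy estimate. -/
theorem IsInvCDF.exists_threshold {A B : ℝ} {φ ψ : ℝ → ℝ} (h : IsInvCDF A B φ ψ) (R : ℕ)
    (y : ℝ) : ∃ Λ : ℕ, ∀ l < R, (ψ (l / R) ≤ y ↔ l < Λ) := by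
  classical
  have hex : ∃ l, ¬(l < R ∧ ψ (l / R) ≤ y) := ⟨R, by simp⟩
  obtain ⟨Λ, h1, h2⟩ : ∃ Λ, ¬(Λ < R ∧ ψ (Λ / R) ≤ y) ∧ ∀ l < Λ, l < R ∧ ψ (l / R) ≤ y :=
    ⟨Nat.find hex, Nat.find_spec hex, fun l hl => not_not.1 (Nat.find_min hex hl)⟩
  refine ⟨Λ, fun l hl => ⟨fun hy => ?_, fun hlt => (h2 l hlt).2⟩⟩
  by_contra hcon
  rw [not_lt] at hcon
  refine h1 ⟨hcon.trans_lt hl, le_trans ?_ hy⟩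
  refine h.strictMonoOn.monotoneOn (div_mem_unit (hcon.trans hl.le)) (div_mem_unit hl.le) ?_
  gcongr

/-- The grid version of the error estimate: the average over a fine dyadic grid is compared with
the sum over the first `n` points of a digital sequence. -/
theorem abs_sum_points_sub_cells_le {s t : ℕ} (hs : 1 ≤ s) {C : Fin s → Matrix ℕ ℕ (ZMod 2)}
    (hC : GeneratesDigitalSequence t C) {a b : Fin s → ℝ} {φ ψ : Fin s → ℝ → ℝ}
    (h : ∀ j, IsInvCDF (a j) (b j) (φ j) (ψ j)) {f : (Fin s → ℝ) → ℝ}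
    (hf : HasMixedPartials a b f) {M : Finset (Fin s) → ℝ}
    (hM : ∀ u, ∀ x ∈ Icc a b, |mixedPartial a b f u x| ≤ M u) {n K m : ℕ}
    (hn : n < 2 ^ (m + 1)) (hmK : m ≤ K) :
    |∑ i ∈ range n, f (fun j => ψ j (pointCell C K i j / (2 ^ K : ℕ))) -
      n / (2 ^ K) ^ s *
        ∑ l : Fin s → Fin (2 ^ K), f (fun j => ψ j (l j / (2 ^ K : ℕ)))| ≤
      ∑ u ∈ Finset.univ.filter (fun u : Finset (Fin s) => u.Nonempty),
        M u * (∏ j ∈ u, (b j - a j)) * (2 ^ t * (m + 1) ^ u.card) := by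
  classical
  let L : Fin n ⊕ (Fin s → Fin (2 ^ K)) → Fin s → ℕ :=
    Sum.elim (fun i => pointCell C K i) (fun l j => l j)
  let w : Fin n ⊕ (Fin s → Fin (2 ^ K)) → ℝ :=
    Sum.elim (fun _ => 1) (fun _ => -(n / (2 ^ K) ^ s))
  let X : Fin n ⊕ (Fin s → Fin (2 ^ K)) → Fin s → ℝ := fun i j => ψ j (L i j / (2 ^ K : ℕ))
  have hL : ∀ i j, L i j < 2 ^ K := by
    rintro (i | l) j
    · exact binVal_lt (digitalDigit_lt _ _) K
    · exact (l j).2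
  have hX : ∀ i, X i ∈ Icc a b := fun i => by
    rw [← Set.pi_univ_Icc]
    exact fun j _ => (h j).mem _ (div_mem_unit (hL i j).le)
  have hsum : ∀ g : Fin n ⊕ (Fin s → Fin (2 ^ K)) → Prop, [DecidablePred g] →
      (∑ i, if g i then w i else 0) = (∑ i : Fin n, if g (Sum.inl i) then (1 : ℝ) else 0) -
        n / (2 ^ K) ^ s * ∑ l : Fin s → Fin (2 ^ K), if g (Sum.inr l) then (1 : ℝ) else 0 := by
    intro g _
    rw [Fintype.sum_sum_type, Finset.mul_sum, sub_eq_add_neg, ← Finset.sum_neg_distrib]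
    congr 1
    refine Finset.sum_congr rfl fun l _ => ?_
    split_ifs <;> simp [w]
  have key := koksma_hlawka_sum (fun j => (h j).lt.le) hf hM w X hX
    (fun u => if u.Nonempty then 2 ^ t * ((m : ℝ) + 1) ^ u.card else 0) (fun u y => by
      choose Λ hΛ using fun j => (h j).exists_threshold (2 ^ K) (y j)
      have hiff : ∀ i, (∀ j ∈ u, X i j ≤ y j) ↔ ∀ j ∈ u, L i j < Λ j := fun i =>
        forall₂_congr fun j _ => hΛ j _ (hL i j)
      rw [Finset.sum_congr rfl fun i _ => if_congr (hiff i) rfl rfl, hsum]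
      split_ifs with hu
      · have := abs_discrepancy_le hs hC hn hmK hu Λ
        rw [← Fin.sum_univ_eq_sum_range (fun i => if ∀ j ∈ u, pointCell C K i j < Λ j
          then (1 : ℝ) else 0)] at this
        exact this
      -- The total signed mass is `n - n = 0`, so `u = ∅` contributes nothing.
      · rw [Finset.not_nonempty_iff_eq_empty] at hu
        subst hu
        simp)
  have e1 : ∑ i, w i * f (X i) =
      ∑ i ∈ range n, f (fun j => ψ j (pointCell C K i j / (2 ^ K : ℕ))) - n / (2 ^ K) ^ s *
        ∑ l : Fin s → Fin (2 ^ K), f (fun j => ψ j (l j / (2 ^ K : ℕ))) := by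
    rw [Fintype.sum_sum_type, Finset.mul_sum, sub_eq_add_neg, ← Finset.sum_neg_distrib,
      ← Fin.sum_univ_eq_sum_range
        (fun i => f (fun j => ψ j (pointCell C K i j / (2 ^ K : ℕ))))]
    simp only [w, X, L, Sum.elim_inl, Sum.elim_inr, one_mul, neg_mul]
  rw [← e1]
  refine key.trans (le_of_eq ?_)
  rw [Finset.sum_filter]
  refine Finset.sum_congr rfl fun u _ => ?_
  split_ifs <;> simp

/-- Error of the quasi-Monte Carlo rule based on `n` points of a digital sequence, transported by
coordinatewise inverse distribution functions. -/
theorem abs_integral_sub_sum_le {s t : ℕ} (hs : 1 ≤ s) {C : Fin s → Matrix ℕ ℕ (ZMod 2)}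
    (hC : GeneratesDigitalSequence t C) (hCtri : ∀ j, IsNonsingularUpperTriangular (C j))
    {a b : Fin s → ℝ} {φ ψ : Fin s → ℝ → ℝ}
    (h : ∀ j, IsInvCDF (a j) (b j) (φ j) (ψ j)) {f : (Fin s → ℝ) → ℝ}
    (hf : HasMixedPartials a b f) {M : Finset (Fin s) → ℝ}
    (hM : ∀ u, ∀ x ∈ Icc a b, |mixedPartial a b f u x| ≤ M u) {n m : ℕ}
    (hn : n < 2 ^ (m + 1)) :
    |n * (∫ x in Icc a b, f x * ∏ j, φ j (x j)) -
        ∑ i ∈ range n, f (fun j => ψ j (digitalPoint C i j))| ≤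
      ∑ u ∈ Finset.univ.filter (fun u : Finset (Fin s) => u.Nonempty),
        M u * (∏ j ∈ u, (b j - a j)) * (2 ^ t * (m + 1) ^ u.card) := by
  set RHS := ∑ u ∈ Finset.univ.filter (fun u : Finset (Fin s) => u.Nonempty),
        M u * (∏ j ∈ u, (b j - a j)) * (2 ^ t * ((m : ℝ) + 1) ^ u.card)
  set E := ∑ j, M {j} * (2 * (b j - a j))
  have ha : a ∈ Icc a b := ⟨le_rfl, fun j => (h j).lt.le⟩
  have hM0 : ∀ u, 0 ≤ M u := fun u => (abs_nonneg _).trans (hM u a ha)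
  -- For `K ≥ m + 1` every index `i < n` is below `2 ^ K`, so the points are exact grid nodes and
  -- only the term `E / 2 ^ K` depends on `K`.
  have hbound : ∀ K, m + 1 ≤ K → |n * (∫ x in Icc a b, f x * ∏ j, φ j (x j)) -
        ∑ i ∈ range n, f (fun j => ψ j (digitalPoint C i j))| ≤ RHS + n * (E / 2 ^ K) := by
    intro K hK
    have h1 := abs_sum_points_sub_cells_le hs hC h hf hM hn (by omega : m ≤ K)
    have h2 := abs_integral_sub_average_le h (fun j => hM0 {j})
      (continuousOn_of_mixedPartials hf hM) (fun x hx y hy => abs_sub_le_sum hf hM hx hy)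
      (R := 2 ^ K) (by positivity)
    have h3 : ∀ i ∈ range n, f (fun j => ψ j (pointCell C K i j / (2 ^ K : ℕ))) =
        f (fun j => ψ j (digitalPoint C i j)) := by
      intro i hi
      have : i < 2 ^ K := (Finset.mem_range.1 hi).trans
        (hn.trans_le (Nat.pow_le_pow_right (by norm_num) hK))
      simp only [digitalPoint_eq hCtri this, pointCell, Nat.cast_pow, Nat.cast_ofNat]
    rw [Finset.sum_congr rfl h3] at h1
    set I := ∫ x in Icc a b, f x * ∏ j, φ j (x j)
    set S := ∑ i ∈ range n, f (fun j => ψ j (digitalPoint C i j))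
    set V := ∑ l : Fin s → Fin (2 ^ K), f (fun j => ψ j (l j / (2 ^ K : ℕ)))
    have hpow : ((2 ^ K : ℕ) : ℝ) = 2 ^ K := by push_cast; rfl
    have h4 : |n * (I - V / (2 ^ K) ^ s)| ≤ n * (E / 2 ^ K) := by
      rw [abs_mul, Nat.abs_cast]
      rw [hpow] at h2
      exact mul_le_mul_of_nonneg_left h2 (Nat.cast_nonneg n)
    have e : n * I - S = n * (I - V / (2 ^ K) ^ s) - (S - n / (2 ^ K) ^ s * V) := by ring
    rw [e]
    have := abs_sub (n * (I - V / (2 ^ K) ^ s)) (S - n / (2 ^ K) ^ s * V)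
    linarith
  have hlim : Filter.Tendsto (fun K : ℕ => RHS + n * (E / 2 ^ K)) Filter.atTop (nhds RHS) := by
    have h0 : Filter.Tendsto (fun K : ℕ => E / (2 : ℝ) ^ K) Filter.atTop (nhds 0) :=
      tendsto_const_nhds.div_atTop (tendsto_pow_atTop_atTop_of_one_lt (by norm_num))
    simpa using (h0.const_mul (n : ℝ)).const_add RHS
  exact ge_of_tendsto hlim (Filter.eventually_atTop.2 ⟨m + 1, hbound⟩)

end HatQMC

/-! ### Hat functions and the hat function approximation -/

namespace HatQMC

open Set Finset MeasureTheory

theorem continuous_hat (a b : ℝ) (m l : ℕ) : Continuous (hat a b m l) := by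
  unfold hat; fun_prop

theorem hat_nonneg (a b : ℝ) (m l : ℕ) (x : ℝ) : 0 ≤ hat a b m l x := le_max_left _ _

section

variable {a b : ℝ} {m l : ℕ}

theorem gridPoint_mem (hab : a < b) (hm : 1 ≤ m) (hl : l ≤ m) : gridPoint a b m l ∈ Icc a b := by
  have hm' : (0 : ℝ) < m := by exact_mod_cast hm
  have hl' : (l : ℝ) ≤ m := by exact_mod_cast hl
  have h1 : 0 ≤ (l : ℝ) * ((b - a) / m) := by
    have := sub_pos.2 hab; positivity
  have h2 : (l : ℝ) * ((b - a) / m) ≤ m * ((b - a) / m) := by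
    have := sub_pos.2 hab; gcongr
  rw [mul_div_cancel₀ _ hm'.ne'] at h2
  unfold gridPoint
  constructor <;> linarith

theorem hatMass_pos (hab : a < b) (hm : 1 ≤ m) (hl : l ≤ m) : 0 < hatMass a b m l :=
  intervalIntegral.integral_pos hab (continuous_hat a b m l).continuousOn
    (fun x _ => hat_nonneg a b m l x) ⟨gridPoint a b m l, gridPoint_mem hab hm hl, by simp [hat]⟩

theorem hat_eq_zero (hab : a < b) (hm : 1 ≤ m) {x : ℝ}
    (hx : (b - a) / m ≤ |x - gridPoint a b m l|) : hat a b m l x = 0 := by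
  have hm' : (0 : ℝ) < m := by exact_mod_cast hm
  have hba := sub_pos.2 hab
  refine max_eq_left ?_
  rw [div_le_iff₀ hm'] at hx
  rw [sub_nonpos, ← mul_div_assoc, one_le_div hba]
  exact hx

theorem continuous_hatDensity (a b : ℝ) (m l : ℕ) : Continuous (hatDensity a b m l) :=
  (continuous_hat a b m l).div_const _

/-- The density vanishes outside the support, so the distribution function is 0 and 1 at the two
ends of the support, and the intermediate value theorem applies. This surjectivity is all that
`Function.invFunOn` needs to give a right inverse. -/
theorem exists_hatCDF_eq (hab : a < b) (hm : 1 ≤ m) (hl : l ≤ m) {z : ℝ} (hz : z ∈ Icc (0 : ℝ) 1) :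
    ∃ x ∈ hatSupport a b m l, hatCDF a b m l x = z := by
  have hm' : (0 : ℝ) < m := by exact_mod_cast hm
  have hba := sub_pos.2 hab
  have hΔ : 0 < (b - a) / m := by positivity
  set Δ := (b - a) / m with hΔdef
  set y := gridPoint a b m l with hy
  have hymem : y ∈ Icc a b := gridPoint_mem hab hm hl
  set lo := max a (y - Δ) with hlo
  set hi := min b (y + Δ) with hhi
  have hlohi : lo ≤ hi :=
    max_le (le_min hab.le (by linarith [hymem.1])) (le_min (by linarith [hymem.2]) (by linarith))
  have hsupp : hatSupport a b m l = Icc lo hi := by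
    rw [hatSupport, Set.Icc_inter_Icc]
  have hcd := continuous_hatDensity a b m l
  have hii : ∀ u v, IntervalIntegrable (hatDensity a b m l) volume u v :=
    fun u v => hcd.intervalIntegrable u v
  have hcont : Continuous (hatCDF a b m l) := by
    unfold hatCDF
    exact intervalIntegral.continuous_primitive hii a
  have h0 : hatCDF a b m l lo = 0 := by
    refine intervalIntegral.integral_zero_ae ?_
    refine Filter.Eventually.of_forall fun x hx => ?_
    rw [uIoc_of_le (le_max_left _ _)] at hx
    have hxy : x ≤ y - Δ := by
      rcases le_max_iff.1 hx.2 with h | h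
      · exact absurd h (not_le.2 hx.1)
      · exact h
    rw [hatDensity, hat_eq_zero hab hm, zero_div]
    rw [abs_sub_comm]
    exact (by linarith : Δ ≤ y - x).trans (le_abs_self _)
  have h1 : hatCDF a b m l hi = 1 := by
    have hb : hatCDF a b m l b = 1 := by
      unfold hatCDF hatDensity
      rw [intervalIntegral.integral_div]
      exact div_self (hatMass_pos hab hm hl).ne'
    have hrest : ∫ x in hi..b, hatDensity a b m l x = 0 := by
      refine intervalIntegral.integral_zero_ae ?_
      refine Filter.Eventually.of_forall fun x hx => ?_
      rw [uIoc_of_le (min_le_left _ _)] at hx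
      have hxy : y + Δ ≤ x := by
        rcases min_lt_iff.1 hx.1 with h | h
        · exact absurd hx.2 (not_le.2 h)
        · exact h.le
      rw [hatDensity, hat_eq_zero hab hm, zero_div]
      exact (by linarith : Δ ≤ x - y).trans (le_abs_self _)
    have := intervalIntegral.integral_add_adjacent_intervals (hii a hi) (hii hi b)
    rw [hrest, add_zero] at this
    exact this.trans hb
  have hivt := intermediate_value_Icc hlohi hcont.continuousOn
  rw [h0, h1] at hivt
  rw [hsupp]
  exact hivt hz

theorem isInvCDF_hat (hab : a < b) (hm : 1 ≤ m) (hl : l ≤ m) :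
    IsInvCDF a b (hatDensity a b m l) (hatInvCDF a b m l) where
  lt := hab
  cont := continuous_hatDensity a b m l
  nonneg x := div_nonneg (hat_nonneg a b m l x) (hatMass_pos hab hm hl).le
  mass := by
    unfold hatDensity
    rw [intervalIntegral.integral_div]
    exact div_self (hatMass_pos hab hm hl).ne'
  mem z hz := (Function.invFunOn_mem (exists_hatCDF_eq hab hm hl hz)).1
  cdf z hz := Function.invFunOn_eq (exists_hatCDF_eq hab hm hl hz)

/-- The truncated formula is exact for every `t ≥ 0`, also beyond `m`; the descending ramp on `[m, m
+ 1]` is what the next triangle fills up. -/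
theorem sum_triangle (t : ℝ) (ht : 0 ≤ t) (m : ℕ) :
    ∑ l ∈ range (m + 1), max 0 (1 - |t - l|) = min 1 (max 0 (m + 1 - t)) := by
  induction m with
  | zero =>
    simp only [zero_add, Finset.sum_range_one, Nat.cast_zero, sub_zero, abs_of_nonneg ht]
    rw [min_eq_right]
    exact max_le zero_le_one (by linarith)
  | succ m ih =>
    rw [Finset.sum_range_succ, ih]
    push_cast
    rcases le_total t m with h | h
    · rw [min_eq_left (le_max_of_le_right (by linarith)),
        min_eq_left (le_max_of_le_right (by linarith)), abs_of_nonpos (by linarith),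
        max_eq_left (by linarith), add_zero]
    · rcases le_total t (m + 1) with h' | h'
      · rw [max_eq_right (by linarith : (0 : ℝ) ≤ m + 1 - t), min_eq_right (by linarith),
          min_eq_left (le_max_of_le_right (by linarith)), abs_of_nonpos (by linarith),
          max_eq_right (by linarith)]
        ring
      · rw [max_eq_left (by linarith : (m : ℝ) + 1 - t ≤ 0), min_eq_right zero_le_one, zero_add,
          abs_of_nonneg (by linarith),
          show (1 : ℝ) - (t - (m + 1)) = m + 1 + 1 - t by ring, min_eq_right]
        exact max_le zero_le_one (by linarith)

/-- The hat functions form a partition of unity. -/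
theorem sum_hat (hab : a < b) (hm : 1 ≤ m) {x : ℝ} (hx : x ∈ Icc a b) :
    ∑ l : Fin (m + 1), hat a b m l x = 1 := by
  have hm' : (0 : ℝ) < m := by exact_mod_cast hm
  have hba := sub_pos.2 hab
  have hxa : 0 ≤ x - a := sub_nonneg.2 hx.1
  have h : ∀ l : ℕ, hat a b m l x = max 0 (1 - |(x - a) * (m / (b - a)) - l|) := by
    intro l
    have e : (x - a) * (m / (b - a)) - l = (x - gridPoint a b m l) * (m / (b - a)) := by
      unfold gridPoint
      field_simp
      ring
    rw [hat, e, abs_mul, abs_of_pos (by positivity : (0 : ℝ) < m / (b - a))]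
  rw [Fin.sum_univ_eq_sum_range (fun l => hat a b m l x)]
  simp only [h]
  rw [sum_triangle _ (by positivity)]
  have : (x - a) * (m / (b - a)) ≤ m := by
    rw [← mul_div_assoc, div_le_iff₀ hba, mul_comm]
    have := hx.2
    gcongr
  exact min_eq_left (le_max_of_le_right (by linarith))

end

section

variable {s : ℕ} {a b : Fin s → ℝ} {m : Fin s → ℕ}

/-- The product hat function with multi-index `k`. -/
noncomputable def hatProd (a b : Fin s → ℝ) (m : Fin s → ℕ) (k : MultiIndex m)
    (x : Fin s → ℝ) : ℝ :=
  ∏ j, hat (a j) (b j) (m j) (k j) (x j)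

/-- The grid point with multi-index `k`. -/
noncomputable def gridVec (a b : Fin s → ℝ) (m : Fin s → ℕ) (k : MultiIndex m) : Fin s → ℝ :=
  fun j => gridPoint (a j) (b j) (m j) (k j)

/-- The hat function approximation of `π`. -/
noncomputable def hatInterp (a b : Fin s → ℝ) (m : Fin s → ℕ) (π : (Fin s → ℝ) → ℝ)
    (x : Fin s → ℝ) : ℝ :=
  ∑ k : MultiIndex m, π (gridVec a b m k) * hatProd a b m k x

theorem gridVec_mem (hab : ∀ j, a j < b j) (hm : ∀ j, 1 ≤ m j) (k : MultiIndex m) :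
    gridVec a b m k ∈ Icc a b := by
  rw [← Set.pi_univ_Icc]
  exact fun j _ => gridPoint_mem (hab j) (hm j) (Nat.lt_succ_iff.1 (k j).2)

theorem continuous_hatProd (k : MultiIndex m) : Continuous (hatProd a b m k) :=
  continuous_finsetProd _ fun j _ => (continuous_hat _ _ _ _).comp (continuous_apply j)

theorem continuous_hatInterp (π : (Fin s → ℝ) → ℝ) : Continuous (hatInterp a b m π) :=
  continuous_finsetSum _ fun k _ => continuous_const.mul (continuous_hatProd k)

theorem hatProd_nonneg (k : MultiIndex m) (x : Fin s → ℝ) : 0 ≤ hatProd a b m k x :=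
  Finset.prod_nonneg fun _ _ => hat_nonneg _ _ _ _ _

theorem sum_hatProd (hab : ∀ j, a j < b j) (hm : ∀ j, 1 ≤ m j) {x : Fin s → ℝ}
    (hx : x ∈ Icc a b) : ∑ k : MultiIndex m, hatProd a b m k x = 1 := by
  have h := Finset.prod_univ_sum (fun j : Fin s => (Finset.univ : Finset (Fin (m j + 1))))
    (fun j l => hat (a j) (b j) (m j) l (x j))
  rw [Fintype.piFinset_univ, Finset.prod_congr rfl fun j _ =>
    sum_hat (hab j) (hm j) ⟨hx.1 j, hx.2 j⟩, Finset.prod_const_one] at h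
  exact h.symm

/-- The hat function approximation of a Hölder continuous function. -/
theorem abs_sub_hatInterp_le (hs : 1 ≤ s) (hab : ∀ j, a j < b j) (hm : ∀ j, 1 ≤ m j)
    {ρ : (Fin s → ℝ) → ℝ} {L β : ℝ} (hβ : 0 < β)
    (hρ : ∀ x ∈ Icc a b, ∀ y ∈ Icc a b, |ρ x - ρ y| ≤ L * ‖x - y‖ ^ β)
    {x : Fin s → ℝ} (hx : x ∈ Icc a b) :
    |ρ x - hatInterp a b m ρ x| ≤ L * ⨆ j, ((b j - a j) / (m j : ℝ)) ^ β := by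
  have : Nonempty (Fin s) := ⟨⟨0, hs⟩⟩
  -- The Hölder condition at the corners `a ≠ b` forces `L ≥ 0`.
  have hL : 0 ≤ L := by
    have h1 := (abs_nonneg _).trans (hρ b ⟨fun j => (hab j).le, le_rfl⟩ a
      ⟨le_rfl, fun j => (hab j).le⟩)
    have h2 : 0 < ‖b - a‖ := norm_pos_iff.2 fun h => by
      have := congrFun h ⟨0, hs⟩
      simp only [Pi.sub_apply, Pi.zero_apply] at this
      linarith [hab ⟨0, hs⟩]
    exact nonneg_of_mul_nonneg_left h1 (Real.rpow_pos_of_pos h2 β)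
  set S := ⨆ j, ((b j - a j) / (m j : ℝ)) ^ β with hS
  have hSj : ∀ j, ((b j - a j) / (m j : ℝ)) ^ β ≤ S := fun j =>
    le_ciSup (f := fun j => ((b j - a j) / (m j : ℝ)) ^ β) (Set.finite_range _).bddAbove j
  have hbase : ∀ j, 0 ≤ (b j - a j) / (m j : ℝ) := fun j =>
    div_nonneg (sub_nonneg.2 (hab j).le) (Nat.cast_nonneg _)
  have e : ρ x - hatInterp a b m ρ x =
      ∑ k : MultiIndex m, (ρ x - ρ (gridVec a b m k)) * hatProd a b m k x := by
    simp only [sub_mul, Finset.sum_sub_distrib, ← Finset.mul_sum, sum_hatProd hab hm hx, mul_one]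
    rfl
  rw [e]
  refine (Finset.abs_sum_le_sum_abs _ _).trans ?_
  calc ∑ k : MultiIndex m, |(ρ x - ρ (gridVec a b m k)) * hatProd a b m k x|
      ≤ ∑ k : MultiIndex m, L * S * hatProd a b m k x := by
        refine Finset.sum_le_sum fun k _ => ?_
        rw [abs_mul, abs_of_nonneg (hatProd_nonneg k x)]
        -- A nonzero product hat places `x` within one mesh width of its node in every coordinate;
        -- `i` below is a coordinate with the largest mesh width.
        by_cases h0 : hatProd a b m k x = 0
        · simp [h0]
        · refine mul_le_mul_of_nonneg_right ?_ (hatProd_nonneg k x)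
          refine (hρ x hx _ (gridVec_mem hab hm k)).trans (mul_le_mul_of_nonneg_left ?_ hL)
          obtain ⟨i, hi⟩ := Finite.exists_max fun j => (b j - a j) / (m j : ℝ)
          refine (Real.rpow_le_rpow (norm_nonneg _) ?_ hβ.le).trans (hSj i)
          rw [pi_norm_le_iff_of_nonneg (hbase i)]
          intro j
          refine le_trans ?_ (hi j)
          by_contra hcon
          push Not at hcon
          exact h0 (Finset.prod_eq_zero (Finset.mem_univ j)
            (hat_eq_zero (hab j) (hm j) hcon.le))
    _ = L * S := by rw [← Finset.mul_sum, sum_hatProd hab hm hx, mul_one]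

theorem setIntegral_hatProd (hab : ∀ j, a j < b j) (k : MultiIndex m) :
    ∫ x in Icc a b, hatProd a b m k x = ∏ j, hatMass (a j) (b j) (m j) (k j) := by
  rw [volume_pi, ← setIntegral_congr_set Measure.univ_pi_Ioc_ae_eq_Icc, Measure.restrict_pi_pi]
  unfold hatProd
  rw [integral_fintype_prod_eq_prod (f := fun j x => hat (a j) (b j) (m j) (k j) x)]
  refine Finset.prod_congr rfl fun j _ => ?_
  rw [hatMass, intervalIntegral.integral_of_le (hab j).le]

/-- Shows that dividing the approximation by the sum of the coefficients gives it total mass 1. -/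
theorem setIntegral_hatInterp (hab : ∀ j, a j < b j) (π : (Fin s → ℝ) → ℝ) :
    ∫ x in Icc a b, hatInterp a b m π x = ∑ k, hatCoeff a b m π k := by
  unfold hatInterp
  rw [integral_finsetSum _ fun k _ =>
    ((continuous_hatProd k).continuousOn.integrableOn_compact isCompact_Icc).const_mul _]
  refine Finset.sum_congr rfl fun k _ => ?_
  rw [integral_const_mul, setIntegral_hatProd hab]
  rfl

theorem setIntegral_mul_hatInterp (hab : ∀ j, a j < b j) (hm : ∀ j, 1 ≤ m j)
    (π : (Fin s → ℝ) → ℝ) {f : (Fin s → ℝ) → ℝ} (hf : ContinuousOn f (Icc a b)) :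
    ∫ x in Icc a b, f x * hatInterp a b m π x =
      ∑ k, hatCoeff a b m π k *
        ∫ x in Icc a b, f x * ∏ j, hatDensity (a j) (b j) (m j) (k j) (x j) := by
  unfold hatInterp
  simp only [Finset.mul_sum]
  refine (integral_finsetSum _ fun k _ => ContinuousOn.integrableOn_compact isCompact_Icc
    (hf.mul (continuous_const.mul (continuous_hatProd k)).continuousOn)).trans ?_
  refine Finset.sum_congr rfl fun k _ => ?_
  rw [← integral_const_mul]
  refine integral_congr_ae (Filter.Eventually.of_forall fun x => ?_)
  have hw : ∏ j, hatMass (a j) (b j) (m j) (k j) ≠ 0 := Finset.prod_ne_zero_iff.2 fun j _ =>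
    (hatMass_pos (hab j) (hm j) (Nat.lt_succ_iff.1 (k j).2)).ne'
  change f x * (π (gridVec a b m k) * hatProd a b m k x) = _
  have hcoeff : hatCoeff a b m π k =
      π (gridVec a b m k) * ∏ j, hatMass (a j) (b j) (m j) (k j) := rfl
  simp only [hatDensity, hatProd, hcoeff, Finset.prod_div_distrib]
  field_simp

end

end HatQMC

/-! ### Hölder's inequality and the weighted norm -/

namespace HatQMC

open Set Finset MeasureTheory

section Hoelder

variable {ι : Type*}

theorem lpAgg_mono {p : ℝ≥0∞} {S T : Finset ι} (h : S ⊆ T) (v : ι → ℝ≥0∞) :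
    lpAgg p S v ≤ lpAgg p T v := by
  unfold lpAgg
  split_ifs
  · exact biSup_mono fun i hi => h hi
  · exact ENNReal.rpow_le_rpow (Finset.sum_le_sum_of_subset h) (by positivity)

theorem le_lpAgg {p : ℝ≥0∞} (hp : 1 ≤ p) {S : Finset ι} (v : ι → ℝ≥0∞) {i : ι} (hi : i ∈ S) :
    v i ≤ lpAgg p S v := by
  unfold lpAgg
  split_ifs with h
  · exact le_iSup₂ (f := fun i (_ : i ∈ S) => v i) i hi
  · have hp0 : p.toReal ≠ 0 := (ENNReal.toReal_pos (zero_lt_one.trans_le hp).ne' h).ne'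
    calc v i = (v i ^ p.toReal) ^ (1 / p.toReal) := by
          rw [← ENNReal.rpow_mul, mul_one_div_cancel hp0, ENNReal.rpow_one]
      _ ≤ _ := ENNReal.rpow_le_rpow
          (Finset.single_le_sum (f := fun i => v i ^ p.toReal) (fun _ _ => zero_le) hi)
          (by positivity)

theorem lpAgg_lt_top {p : ℝ≥0∞} {S : Finset ι} {v : ι → ℝ≥0∞} (hv : ∀ i ∈ S, v i < ∞) :
    lpAgg p S v < ∞ := by
  unfold lpAgg
  split_ifs
  · refine lt_of_le_of_lt (iSup₂_le fun i hi => ?_) (ENNReal.sum_lt_top.2 hv)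
    exact Finset.single_le_sum (f := v) (fun _ _ => zero_le) hi
  · refine ENNReal.rpow_lt_top_of_nonneg (by positivity) (ENNReal.sum_lt_top.2 fun i hi => ?_).ne
    exact ENNReal.rpow_lt_top_of_nonneg ENNReal.toReal_nonneg (hv i hi).ne

theorem sum_mul_le_lpAgg_top (S : Finset ι) (u v : ι → ℝ≥0∞) :
    ∑ i ∈ S, u i * v i ≤ lpAgg ∞ S u * lpAgg 1 S v := by
  have h1 : lpAgg 1 S v = ∑ i ∈ S, v i := by simp [lpAgg]
  rw [h1, Finset.mul_sum]
  exact Finset.sum_le_sum fun i hi => mul_le_mul_left (le_lpAgg le_top u hi) _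

/-- Hölder's inequality for `lpAgg`. -/
theorem sum_mul_le_lpAgg {p q : ℝ≥0∞} (hpq : 1 / p + 1 / q = 1) (S : Finset ι)
    (u v : ι → ℝ≥0∞) : ∑ i ∈ S, u i * v i ≤ lpAgg p S u * lpAgg q S v := by
  rcases eq_or_ne p ∞ with rfl | hp
  · have : q = 1 := by simpa using hpq
    subst this
    exact sum_mul_le_lpAgg_top S u v
  rcases eq_or_ne q ∞ with rfl | hq
  · have : p = 1 := by simpa using hpq
    subst this
    rw [mul_comm (lpAgg 1 S u)]
    simpa only [mul_comm] using sum_mul_le_lpAgg_top S v u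
  have hp0 : p ≠ 0 := by rintro rfl; simp at hpq
  have hq0 : q ≠ 0 := by rintro rfl; simp at hpq
  have hpp := ENNReal.toReal_pos hp0 hp
  have hqp := ENNReal.toReal_pos hq0 hq
  have hsum : p.toReal⁻¹ + q.toReal⁻¹ = 1 := by
    have := congrArg ENNReal.toReal hpq
    rw [one_div, one_div, ENNReal.toReal_add (by simpa) (by simpa), ENNReal.toReal_inv,
      ENNReal.toReal_inv, ENNReal.toReal_one] at this
    exact this
  have hconj : p.toReal.HolderConjugate q.toReal := by
    rw [Real.holderConjugate_iff]
    refine ⟨?_, hsum⟩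
    have : 0 < q.toReal⁻¹ := by positivity
    exact (inv_lt_one₀ hpp).1 (by linarith)
  simpa only [lpAgg, hp, hq, if_false] using ENNReal.inner_le_Lp_mul_Lq S u v hconj

end Hoelder

section WeightedNorm

variable {s : ℕ} {a b : Fin s → ℝ} {γ : Finset (Fin s) → ℝ} {p q : ℝ≥0∞}
  {f : (Fin s → ℝ) → ℝ}

/-- The supremum norm of the mixed partial derivative with respect to the variables in `u`. -/
noncomputable def supPartial (a b : Fin s → ℝ) (f : (Fin s → ℝ) → ℝ) (u : Finset (Fin s)) :
    ℝ≥0∞ :=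
  ⨆ x ∈ Icc a b, ENNReal.ofReal |mixedPartial a b f u x|

theorem supPartial_div_le (hp : 1 ≤ p) (u : Finset (Fin s)) :
    supPartial a b f u / ENNReal.ofReal (γ u) ≤ weightedNorm a b γ p f :=
  le_lpAgg hp (fun u => supPartial a b f u / ENNReal.ofReal (γ u)) (Finset.mem_univ u)

theorem supPartial_ne_top (hp : 1 ≤ p) (hfin : weightedNorm a b γ p f < ∞)
    (u : Finset (Fin s)) : supPartial a b f u ≠ ∞ := by
  intro h
  have h1 := (supPartial_div_le hp u).trans_lt hfin
  rw [h, ENNReal.top_div_of_ne_top ENNReal.ofReal_ne_top] at h1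
  exact lt_irrefl _ h1

theorem abs_mixedPartial_le (hp : 1 ≤ p) (hfin : weightedNorm a b γ p f < ∞)
    (u : Finset (Fin s)) (x : Fin s → ℝ) (hx : x ∈ Icc a b) :
    |mixedPartial a b f u x| ≤ (supPartial a b f u).toReal := by
  rw [← ENNReal.ofReal_le_iff_le_toReal (supPartial_ne_top hp hfin u)]
  exact le_iSup₂ (f := fun x (_ : x ∈ Icc a b) => ENNReal.ofReal |mixedPartial a b f u x|) x hx

/-- Only the term `u = ∅` is used; `γ ∅ ≤ 1` means that dividing by it does not decrease the
supremum of `|f|`. -/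
theorem abs_le_weightedNorm (hγ : γ ∅ ≤ 1) (hp : 1 ≤ p)
    (hfin : weightedNorm a b γ p f < ∞) {x : Fin s → ℝ} (hx : x ∈ Icc a b) :
    |f x| ≤ (weightedNorm a b γ p f).toReal := by
  have h1 := abs_mixedPartial_le hp hfin ∅ x hx
  rw [mixedPartial_empty] at h1
  refine h1.trans (ENNReal.toReal_mono hfin.ne (le_trans ?_ (supPartial_div_le hp ∅)))
  rw [ENNReal.div_eq_inv_mul]
  exact le_mul_of_one_le_left' (ENNReal.one_le_inv.2 (ENNReal.ofReal_le_one.2 hγ))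

/-- Hölder's inequality after inserting `γ u / γ u` into each term. -/
theorem sum_supPartial_mul_le (hab : ∀ j, a j < b j) (hγ : ∀ u, 0 < γ u) (hp : 1 ≤ p)
    (hpq : 1 / p + 1 / q = 1) (hfin : weightedNorm a b γ p f < ∞) {N : ℕ} (hN : 1 ≤ N) :
    ∑ u ∈ Finset.univ.filter (fun u : Finset (Fin s) => u.Nonempty),
      (supPartial a b f u).toReal * ∏ j ∈ u, (3 * (b j - a j) * Real.log N) ≤
      (weightedNorm a b γ p f).toReal * Gconst a b γ q N := by
  set S := Finset.univ.filter (fun u : Finset (Fin s) => u.Nonempty)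
  set P : Finset (Fin s) → ℝ := fun u => ∏ j ∈ u, (3 * (b j - a j) * Real.log N) with hP
  have hP0 : ∀ u, 0 ≤ P u := fun u => Finset.prod_nonneg fun j _ => by
    have := sub_pos.2 (hab j)
    have : 0 ≤ Real.log N := Real.log_nonneg (by exact_mod_cast hN)
    positivity
  have hG : lpAgg q S (fun u => ENNReal.ofReal (γ u * P u)) < ∞ :=
    lpAgg_lt_top fun u _ => ENNReal.ofReal_lt_top
  have h := (sum_mul_le_lpAgg hpq S (fun u => supPartial a b f u / ENNReal.ofReal (γ u))
    (fun u => ENNReal.ofReal (γ u * P u))).trans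
      (mul_le_mul_left (lpAgg_mono (Finset.subset_univ S) _) _)
  have h2 := ENNReal.toReal_mono (ENNReal.mul_lt_top hfin hG).ne h
  rw [ENNReal.toReal_mul, ENNReal.toReal_sum] at h2
  · refine le_trans (le_of_eq (Finset.sum_congr rfl fun u _ => ?_)) h2
    rw [ENNReal.toReal_mul, ENNReal.toReal_div, ENNReal.toReal_ofReal (hγ u).le,
      ENNReal.toReal_ofReal (mul_nonneg (hγ u).le (hP0 u))]
    have := (hγ u).ne'
    field_simp
    rfl
  · intro u _
    exact ENNReal.mul_ne_top ((supPartial_div_le hp u).trans_lt hfin).ne ENNReal.ofReal_ne_top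

/-- For `N ≥ 2` the integer `Nat.log 2 N` is at least 1, so the left side is at most `2 * Nat.log 2
N ≤ 2 log N / log 2`, and `2 / log 2 < 3`. -/
theorem log_two_add_one_le {N : ℕ} (hN : 2 ≤ N) : (Nat.log 2 N : ℝ) + 1 ≤ 3 * Real.log N := by
  have h1 : 1 ≤ Nat.log 2 N := Nat.log_pos (by norm_num) hN
  have h2 : (2 : ℝ) ^ Nat.log 2 N ≤ N := by exact_mod_cast Nat.pow_log_le_self 2 (by omega)
  have h3 := Real.log_le_log (by positivity) h2
  rw [Real.log_pow] at h3
  have h4 := Real.log_two_gt_d9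
  have h5 : (1 : ℝ) ≤ Nat.log 2 N := by exact_mod_cast h1
  nlinarith

/-- The product on the right already dominates through `log_two_add_one_le`; of `5 log (2N)` only
the fact that it is at least 1 is used. -/
theorem discrepancy_bound_le (hab : ∀ j, a j < b j) {N : ℕ} (hN : 2 ≤ N) (t : ℕ)
    (u : Finset (Fin s)) :
    (∏ j ∈ u, (b j - a j)) * (2 ^ t * ((Nat.log 2 N : ℕ) + 1 : ℝ) ^ u.card) ≤
      5 * 2 ^ t * Real.log (2 * N) * ∏ j ∈ u, (3 * (b j - a j) * Real.log N) := by
  have hlogN : 0 ≤ Real.log N := Real.log_nonneg (by exact_mod_cast (by omega : 1 ≤ N))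
  have h1 : (∏ j ∈ u, (b j - a j)) * ((Nat.log 2 N : ℕ) + 1 : ℝ) ^ u.card ≤
      ∏ j ∈ u, (3 * (b j - a j) * Real.log N) := by
    rw [← Finset.prod_const, ← Finset.prod_mul_distrib]
    refine Finset.prod_le_prod (fun j _ => ?_) fun j _ => ?_
    · have := sub_pos.2 (hab j); positivity
    · have := mul_le_mul_of_nonneg_left (log_two_add_one_le hN) (sub_pos.2 (hab j)).le
      linarith
  have h2 : (1 : ℝ) ≤ 5 * Real.log (2 * N) := by
    have hN' : (2 : ℝ) ≤ 2 * N := by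
      have : (2 : ℝ) ≤ N := by exact_mod_cast hN
      linarith
    have := Real.log_le_log (by norm_num) hN'
    have := Real.log_two_gt_d9
    linarith
  have h3 : 0 ≤ ∏ j ∈ u, (3 * (b j - a j) * Real.log N) :=
    Finset.prod_nonneg fun j _ => by have := sub_pos.2 (hab j); positivity
  calc _ = 2 ^ t * ((∏ j ∈ u, (b j - a j)) * ((Nat.log 2 N : ℕ) + 1 : ℝ) ^ u.card) := by ring
    _ ≤ 2 ^ t * ∏ j ∈ u, (3 * (b j - a j) * Real.log N) := by gcongr
    _ ≤ (2 ^ t * ∏ j ∈ u, (3 * (b j - a j) * Real.log N)) * (5 * Real.log (2 * N)) :=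
        le_mul_of_one_le_right (by positivity) h2
    _ = _ := by ring

end WeightedNorm

/-! ### Error of the mixture rule -/

section Mixture

variable {ι : Type*} [Fintype ι]

theorem sum_div_ordering {c : ι → ℝ} (hc : 0 < ∑ k, c k) (e : Fin (Fintype.card ι) ≃ ι) :
    ∑ v, c (e v) / ∑ k, c k = 1 := by
  rw [← Finset.sum_div, Equiv.sum_comp e c, div_self hc.ne']

/-- If `n I k` differs from the sum over the first `n` nodes by at most `B₁` for all components `k`
and all `n ≤ N`, the error of the mixture rule is of the order `r / N`. -/
theorem abs_sum_sub_mixtureQMC_le {X : Type*} {c : ι → ℝ} (hc0 : ∀ k, 0 ≤ c k)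
    (hc : 0 < ∑ k, c k) (e : Fin (Fintype.card ι) ≃ ι) (Φinv : ι → X → X) (y : ℕ → X) {N : ℕ}
    {δ : ℝ} (hδ0 : 0 < δ) (hδN : δ < N) (f : X → ℝ) (I : ι → ℝ) {B₀ B₁ : ℝ} (hB₀ : 0 ≤ B₀)
    (hB₁ : 0 ≤ B₁) (hI : ∀ k, |I k| ≤ B₀)
    (herr : ∀ k n, n ≤ N → |n * I k - ∑ i ∈ range n, f (Φinv k (y i))| ≤ B₁) :
    |(∑ k, c k * I k) / (∑ k, c k) - mixtureQMC c e Φinv y N δ f| ≤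
      (δ + 3 * (mixRank c e N δ : ℝ) - 2) / N * (B₀ + B₁) := by
  have hN : (0 : ℝ) < N := hδ0.trans hδN
  set p : Fin (Fintype.card ι) → ℝ := fun v => c (e v) / ∑ k, c k with hp
  have hp0 : ∀ v, 0 ≤ p v := fun v => div_nonneg (hc0 _) hc.le
  have hp1 : ∑ v, p v = 1 := sum_div_ordering hc e
  set r := mixRank c e N δ with hr
  set F : ℕ → Finset (Fin (Fintype.card ι)) := fun r =>
    Finset.univ.filter (fun v : Fin (Fintype.card ι) => (v : ℕ) < r) with hF
  -- All indices together satisfy the defining condition, so the infimum defining `r` is attained.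
  have hfull : Fintype.card ι ∈ {r : ℕ | 1 - δ / N ≤ ∑ v ∈ F r, p v} := by
    have : F (Fintype.card ι) = Finset.univ := by ext v; simp [hF]
    rw [Set.mem_ofPred_eq, this, hp1]
    have : 0 < δ / N := by positivity
    linarith
  have hrmem : 1 - δ / N ≤ ∑ v ∈ F r, p v := Nat.sInf_mem ⟨_, hfull⟩
  have hrcard : r ≤ Fintype.card ι := Nat.sInf_le hfull
  have hδ1 : δ / N < 1 := (div_lt_one hN).2 hδN
  have hr1 : 1 ≤ r := by
    by_contra h0
    have : r = 0 := by omega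
    rw [this] at hrmem
    simp only [hF, Nat.not_lt_zero, Finset.filter_false, Finset.sum_empty] at hrmem
    linarith
  -- Minimality of `r`: the weights before the last kept index sum to less than 1, which later makes
  -- the last sample size positive.
  have hrlt : ∀ v : Fin (Fintype.card ι), (v : ℕ) + 1 = r →
      ∑ w ∈ Finset.univ.filter (fun w => w < v), p w < 1 - δ / N := by
    intro v hv
    have h1 : (v : ℕ) ∉ {r : ℕ | 1 - δ / N ≤ ∑ v ∈ F r, p v} :=
      Nat.notMem_of_lt_sInf (show (v : ℕ) < r by omega)
    rw [Set.mem_ofPred_eq, not_le] at h1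
    have h2 : Finset.univ.filter (fun w => w < v) = F v := by ext w; simp [hF]
    rw [h2]
    exact h1
  set n : Fin (Fintype.card ι) → ℕ := sampleSize c e N δ with hn
  have hfloor : ∀ v, floorSize c N (e v) = ⌊(N : ℝ) * p v⌋₊ := fun v => by
    rw [floorSize, hp, mul_div_assoc]
  set S : Fin (Fintype.card ι) → ℝ := fun v => ∑ i ∈ range (n v), f (Φinv (e v) (y i)) with hS
  -- A rounded size `n v ≥ 1` has `N p_v < n v + 1 ≤ 2 n v` and costs `2 B₁ / N`. A rounded size 0
  -- has `N p_v < 1`, and the lost term costs `B₀ / N`. The last index costs only `B₁ / N`, which is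
  -- the reason for the subtraction.
  have hterm : ∀ v ∈ F r, |p v * I (e v) - p v / n v * S v| ≤
      (B₀ + 2 * B₁) / N - if (v : ℕ) + 1 = r then (B₀ + B₁) / N else 0 := by
    intro v hv
    have hmain : ∀ κ : ℝ, n v ≠ 0 → n v ≤ N → N * p v ≤ κ * n v →
        |p v * I (e v) - p v / n v * S v| ≤ κ * B₁ / N := by
      intro κ hn0 hnN hκ
      have hnpos : (0 : ℝ) < n v := by exact_mod_cast Nat.pos_of_ne_zero hn0
      have e1 : p v * I (e v) - p v / n v * S v = p v / n v * (n v * I (e v) - S v) := by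
        field_simp
      rw [e1, abs_mul, abs_of_nonneg (div_nonneg (hp0 v) hnpos.le)]
      calc p v / n v * |n v * I (e v) - S v| ≤ p v / n v * B₁ :=
            mul_le_mul_of_nonneg_left (herr (e v) (n v) hnN) (div_nonneg (hp0 v) hnpos.le)
        _ ≤ κ / N * B₁ := by
            refine mul_le_mul_of_nonneg_right ?_ hB₁
            rw [div_le_div_iff₀ hnpos hN]
            linarith
        _ = _ := by ring
    by_cases hvr : (v : ℕ) + 1 = r
    · have hnv : n v = N - ∑ w ∈ Finset.univ.filter (fun w => w < v), floorSize c N (e w) := by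
        simp only [hn, sampleSize]
        rw [if_pos hvr]
      have hle : ((∑ w ∈ Finset.univ.filter (fun w => w < v), floorSize c N (e w) : ℕ) : ℝ) ≤
          N * ∑ w ∈ Finset.univ.filter (fun w => w < v), p w := by
        push_cast
        rw [Finset.mul_sum]
        refine Finset.sum_le_sum fun w _ => ?_
        rw [hfloor]
        exact Nat.floor_le (mul_nonneg hN.le (hp0 w))
      have hlt := hrlt v hvr
      have hlt1 : ∑ w ∈ Finset.univ.filter (fun w => w < v), p w < 1 := by
        have : 0 < δ / N := by positivity
        linarith
      have hltN : ((∑ w ∈ Finset.univ.filter (fun w => w < v), floorSize c N (e w) : ℕ) : ℝ) < N :=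
        hle.trans_lt (by nlinarith)
      have hltN' := Nat.cast_lt.1 hltN
      have hn0 : n v ≠ 0 := by omega
      have hcast : (n v : ℝ) =
          N - (∑ w ∈ Finset.univ.filter (fun w => w < v), floorSize c N (e w) : ℕ) := by
        rw [hnv, Nat.cast_sub hltN'.le]
      -- The remainder satisfies `n v ≥ N - N ∑_{w < v} p_w ≥ N p_v`, so the last index is never
      -- undersampled and `hmain` applies with `κ = 1`.
      have hpv : ∑ w ∈ Finset.univ.filter (fun w => w < v), p w + p v ≤ 1 := by
        rw [add_comm, ← Finset.sum_insert (by simp), ← hp1]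
        exact Finset.sum_le_sum_of_subset_of_nonneg (Finset.subset_univ _) fun i _ _ => hp0 i
      have := hmain 1 hn0 (by omega) (by rw [one_mul, hcast]; nlinarith)
      rw [if_pos hvr]
      refine this.trans (le_of_eq ?_)
      ring
    · have hnv : n v = ⌊(N : ℝ) * p v⌋₊ := by
        simp only [hn, sampleSize]
        rw [if_neg hvr, hfloor]
      have hlt : N * p v < n v + 1 := by rw [hnv]; exact Nat.lt_floor_add_one _
      rw [if_neg hvr, sub_zero]
      by_cases hn0 : n v = 0
      · rw [hn0] at hlt ⊢
        simp only [Nat.cast_zero, div_zero, zero_mul, sub_zero, zero_add] at hlt ⊢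
        rw [abs_mul, abs_of_nonneg (hp0 v), le_div_iff₀ hN]
        have : N * p v * |I (e v)| ≤ 1 * B₀ :=
          mul_le_mul hlt.le (hI _) (abs_nonneg _) zero_le_one
        linarith
      · have hpv : p v ≤ 1 := by
          rw [← hp1]; exact Finset.single_le_sum (fun i _ => hp0 i) (Finset.mem_univ v)
        have hle : (n v : ℝ) ≤ N := by
          rw [hnv]
          exact (Nat.floor_le (mul_nonneg hN.le (hp0 v))).trans
            (mul_le_of_le_one_right hN.le hpv)
        have hn1 : (1 : ℝ) ≤ n v := by exact_mod_cast Nat.one_le_iff_ne_zero.2 hn0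
        refine (hmain 2 hn0 (by exact_mod_cast hle) (by linarith)).trans ?_
        gcongr
        linarith
  have hcardF : (F r).card = r := by
    have h1 : F r = Finset.univ.filter (fun v : Fin (Fintype.card ι) => (v : ℕ) < r) := rfl
    rw [h1, Fin.card_filter_val_lt, min_eq_right hrcard]
  have hsum1 : ∑ v ∈ F r, |p v * I (e v) - p v / n v * S v| ≤
      r * ((B₀ + 2 * B₁) / N) - (B₀ + B₁) / N := by
    refine (Finset.sum_le_sum hterm).trans (le_of_eq ?_)
    have hv0 : r - 1 < Fintype.card ι := by omega
    have hiff : ∀ v : Fin (Fintype.card ι), (v : ℕ) + 1 = r ↔ v = ⟨r - 1, hv0⟩ := fun v => by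
      rw [Fin.ext_iff]; simp only; omega
    simp only [hiff]
    rw [Finset.sum_sub_distrib, Finset.sum_const, hcardF, nsmul_eq_mul, Finset.sum_ite_eq']
    rw [if_pos (by simp only [hF, Finset.mem_filter, Finset.mem_univ, true_and]; omega)]
  have hsplit : ∑ v ∈ (F r)ᶜ, p v ≤ δ / N := by
    have := Finset.sum_add_sum_compl (F r) p
    rw [hp1] at this
    linarith
  have hsum2 : |∑ v ∈ (F r)ᶜ, p v * I (e v)| ≤ δ / N * B₀ := by
    refine (Finset.abs_sum_le_sum_abs _ _).trans ?_
    calc ∑ v ∈ (F r)ᶜ, |p v * I (e v)| ≤ ∑ v ∈ (F r)ᶜ, p v * B₀ := by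
          refine Finset.sum_le_sum fun v _ => ?_
          rw [abs_mul, abs_of_nonneg (hp0 v)]
          exact mul_le_mul_of_nonneg_left (hI _) (hp0 v)
      _ ≤ _ := by
          rw [← Finset.sum_mul]
          exact mul_le_mul_of_nonneg_right hsplit hB₀
  have e1 : (∑ k, c k * I k) / (∑ k, c k) = ∑ v, p v * I (e v) := by
    rw [← Equiv.sum_comp e, Finset.sum_div]
    exact Finset.sum_congr rfl fun v _ => by simp only [hp]; ring
  have e2 : mixtureQMC c e Φinv y N δ f = ∑ v ∈ F r, p v / n v * S v := by
    unfold mixtureQMC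
    rw [Finset.mul_sum]
    refine Finset.sum_congr rfl fun v _ => ?_
    simp only [hp, hS, hn]
    ring
  rw [e1, e2, ← Finset.sum_add_sum_compl (F r)]
  have e3 : ∑ v ∈ F r, p v * I (e v) + ∑ v ∈ (F r)ᶜ, p v * I (e v) - ∑ v ∈ F r, p v / n v * S v =
      ∑ v ∈ F r, (p v * I (e v) - p v / n v * S v) + ∑ v ∈ (F r)ᶜ, p v * I (e v) := by
    rw [Finset.sum_sub_distrib]; ring
  rw [e3]
  refine (abs_add_le _ _).trans ((add_le_add ((Finset.abs_sum_le_sum_abs _ _).trans hsum1)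
    hsum2).trans ?_)
  have hr1' : (1 : ℝ) ≤ r := by exact_mod_cast hr1
  -- The slack between the stated bound and the one collected; it is nonnegative because `r ≥ 1`.
  have : (δ + 3 * (r : ℝ) - 2) / N * (B₀ + B₁) -
      (r * ((B₀ + 2 * B₁) / N) - (B₀ + B₁) / N + δ / N * B₀) =
      ((2 * r - 1) * B₀ + (δ + r - 1) * B₁) / N := by
    field_simp; ring
  have h2 : 0 ≤ ((2 * r - 1) * B₀ + (δ + r - 1) * B₁) / N :=
    div_nonneg (add_nonneg (mul_nonneg (by linarith) hB₀) (mul_nonneg (by linarith) hB₁)) hN.le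
  linarith

end Mixture

end HatQMC

/-! ### Replacing the density by its approximation -/

namespace HatQMC

open Set Finset MeasureTheory

variable {s : ℕ} {a b : Fin s → ℝ} {m : Fin s → ℕ}

/-- The integral of a nonintegrable function has the default value 0, so the value 1 forces
integrability. -/
theorem integrableOn_of_integral_eq_one {ρ : (Fin s → ℝ) → ℝ} {S : Set (Fin s → ℝ)}
    (h : ∫ x in S, ρ x = 1) : IntegrableOn ρ S := by
  by_contra hn
  rw [integral_undef hn] at h
  exact zero_ne_one h

/-- Replacing the density by its normalized hat function approximation. -/
theorem abs_integral_sub_hatInterp_le (hs : 1 ≤ s) (hab : ∀ j, a j < b j) (hm : ∀ j, 1 ≤ m j)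
    {ρ : (Fin s → ℝ) → ℝ} (hρint : ∫ x in Icc a b, ρ x = 1) {L β : ℝ} (hβ : 0 < β)
    (hρ : ∀ x ∈ Icc a b, ∀ y ∈ Icc a b, |ρ x - ρ y| ≤ L * ‖x - y‖ ^ β)
    (hρ0 : ∀ x ∈ Icc a b, 0 ≤ ρ x) {f : (Fin s → ℝ) → ℝ} (hf : ContinuousOn f (Icc a b))
    (hc : 0 < ∑ k, hatCoeff a b m ρ k) :
    |(∫ x in Icc a b, f x * ρ x) -
        (∫ x in Icc a b, f x * hatInterp a b m ρ x) / ∑ k, hatCoeff a b m ρ k| ≤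
      2 * (eLpNorm f ∞ (volume.restrict (Icc a b))).toReal * L * (∏ j, (b j - a j)) *
        (⨆ j, ((b j - a j) / (m j : ℝ)) ^ β) := by
  set κ := ∑ k, hatCoeff a b m ρ k with hκ
  set S := ⨆ j, ((b j - a j) / (m j : ℝ)) ^ β
  set F := (eLpNorm f ∞ (volume.restrict (Icc a b))).toReal with hF
  have hF0 : 0 ≤ F := ENNReal.toReal_nonneg
  have hdiff : ∀ x ∈ Icc a b, |ρ x - hatInterp a b m ρ x| ≤ L * S := fun x hx =>
    abs_sub_hatInterp_le hs hab hm hβ hρ hx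
  have hvol : volume.real (Icc a b) = ∏ j, (b j - a j) :=
    Real.volume_Icc_pi_toReal fun j => (hab j).le
  have hρi : IntegrableOn ρ (Icc a b) := integrableOn_of_integral_eq_one hρint
  have hHi : IntegrableOn (hatInterp a b m ρ) (Icc a b) :=
    (continuous_hatInterp ρ).continuousOn.integrableOn_compact isCompact_Icc
  have hfρ : IntegrableOn (fun x => f x * ρ x) (Icc a b) := hρi.continuousOn_mul hf isCompact_Icc
  have hfH : IntegrableOn (fun x => f x * hatInterp a b m ρ x) (Icc a b) :=
    hHi.continuousOn_mul hf isCompact_Icc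
  have hH0 : ∀ x, 0 ≤ hatInterp a b m ρ x := fun x => Finset.sum_nonneg fun k _ =>
    mul_nonneg (hρ0 _ (gridVec_mem hab hm k)) (hatProd_nonneg k x)
  have hHκ : ∫ x in Icc a b, hatInterp a b m ρ x = κ := setIntegral_hatInterp hab ρ
  have hfF : ∀ᵐ x ∂(volume.restrict (Icc a b)), |f x| ≤ F := by
    obtain ⟨B, hB⟩ := isCompact_Icc.exists_bound_of_continuousOn hf
    have hfin : eLpNorm f ∞ (volume.restrict (Icc a b)) ≠ ∞ := by
      rw [eLpNorm_exponent_top]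
      refine (eLpNormEssSup_lt_top_of_ae_bound (C := B) ?_).ne
      filter_upwards [ae_restrict_mem measurableSet_Icc] with x hx using hB x hx
    have := ae_le_eLpNormEssSup (f := f) (μ := volume.restrict (Icc a b))
    filter_upwards [this] with x hx
    rw [← eLpNorm_exponent_top] at hx
    have := ENNReal.toReal_mono hfin hx
    rwa [toReal_enorm, Real.norm_eq_abs] at this
  have hI1 : |∫ x in Icc a b, (f x * ρ x - f x * hatInterp a b m ρ x)| ≤
      F * (L * S) * ∏ j, (b j - a j) := by
    rw [← Real.norm_eq_abs]
    refine (norm_integral_le_of_norm_le (g := fun _ => F * (L * S)) ?_ ?_).trans (le_of_eq ?_)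
    · exact integrableOn_const (by exact isCompact_Icc.measure_lt_top.ne)
    · filter_upwards [hfF, ae_restrict_mem measurableSet_Icc] with x hx hxm
      rw [← mul_sub, norm_mul]
      exact mul_le_mul hx (hdiff x hxm) (abs_nonneg _) hF0
    · rw [setIntegral_const, hvol, smul_eq_mul, mul_comm]
  have hI2 : |∫ x in Icc a b, f x * hatInterp a b m ρ x| ≤ F * κ := by
    rw [← Real.norm_eq_abs]
    refine (norm_integral_le_of_norm_le (g := fun x => F * hatInterp a b m ρ x)
      (hHi.const_mul F) ?_).trans (le_of_eq ?_)
    · filter_upwards [hfF] with x hx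
      rw [norm_mul, Real.norm_of_nonneg (hH0 x)]
      exact mul_le_mul_of_nonneg_right hx (hH0 x)
    · rw [integral_const_mul, hHκ]
  have hI3 : |1 - κ| ≤ L * S * ∏ j, (b j - a j) := by
    rw [← hρint, ← hHκ, ← integral_sub hρi hHi, ← Real.norm_eq_abs, ← hvol]
    exact norm_setIntegral_le_of_norm_le_const isCompact_Icc.measure_lt_top hdiff
  rw [integral_sub hfρ hfH] at hI1
  set I₁ := ∫ x in Icc a b, f x * ρ x
  set I₂ := ∫ x in Icc a b, f x * hatInterp a b m ρ x
  -- The first difference is the approximation error, the second the normalization error. Since `|I₂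
  -- / κ| ≤ F`, both are at most `F * (L * S)` times the volume.
  have e : I₁ - I₂ / κ = (I₁ - I₂) - I₂ / κ * (1 - κ) := by
    field_simp; ring
  have hI4 : |I₂ / κ| ≤ F := by
    rw [abs_div, abs_of_pos hc, div_le_iff₀ hc]; exact hI2
  have hI5 : |I₂ / κ * (1 - κ)| ≤ F * (L * S * ∏ j, (b j - a j)) := by
    rw [abs_mul]
    exact mul_le_mul hI4 hI3 (abs_nonneg _) hF0
  rw [e]
  have := abs_sub (I₁ - I₂) (I₂ / κ * (1 - κ))
  linarith

theorem abs_integral_mul_hatDensity_le (hab : ∀ j, a j < b j) (hm : ∀ j, 1 ≤ m j)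
    {f : (Fin s → ℝ) → ℝ} {B : ℝ} (hB : ∀ x ∈ Icc a b, |f x| ≤ B) (k : MultiIndex m) :
    |∫ x in Icc a b, f x * ∏ j, hatDensity (a j) (b j) (m j) (k j) (x j)| ≤ B := by
  have hw : ∀ j, 0 < hatMass (a j) (b j) (m j) (k j) := fun j =>
    hatMass_pos (hab j) (hm j) (Nat.lt_succ_iff.1 (k j).2)
  have e : ∀ x : Fin s → ℝ, ∏ j, hatDensity (a j) (b j) (m j) (k j) (x j) =
      hatProd a b m k x / ∏ j, hatMass (a j) (b j) (m j) (k j) := fun x => by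
    simp only [hatDensity, hatProd, Finset.prod_div_distrib]
  have hw' : 0 < ∏ j, hatMass (a j) (b j) (m j) (k j) := Finset.prod_pos fun j _ => hw j
  have h0 : ∀ x, 0 ≤ hatProd a b m k x / ∏ j, hatMass (a j) (b j) (m j) (k j) := fun x =>
    div_nonneg (hatProd_nonneg k x) hw'.le
  simp only [e]
  rw [← Real.norm_eq_abs]
  refine (norm_integral_le_of_norm_le
    (g := fun x => B * (hatProd a b m k x / ∏ j, hatMass (a j) (b j) (m j) (k j))) ?_ ?_).trans
      (le_of_eq ?_)
  · exact (((continuous_hatProd k).continuousOn.integrableOn_compact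
      isCompact_Icc).div_const _).const_mul B
  · filter_upwards [ae_restrict_mem measurableSet_Icc] with x hx
    rw [norm_mul, Real.norm_of_nonneg (h0 x)]
    exact mul_le_mul_of_nonneg_right (hB x hx) (h0 x)
  · rw [integral_const_mul, integral_div, setIntegral_hatProd hab, div_self hw'.ne', mul_one]

theorem hatCoeff_nonneg (hab : ∀ j, a j < b j) (hm : ∀ j, 1 ≤ m j) {π : (Fin s → ℝ) → ℝ}
    (hπ : ∀ x ∈ Icc a b, 0 ≤ π x) (k : MultiIndex m) : 0 ≤ hatCoeff a b m π k :=
  mul_nonneg (hπ _ (gridVec_mem hab hm k)) (Finset.prod_nonneg fun j _ =>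
    (hatMass_pos (hab j) (hm j) (Nat.lt_succ_iff.1 (k j).2)).le)

end HatQMC

/-! ### Assembly of the error bound -/

theorem theorem2
    -- the box, the weights and the conjugate exponents
    (s : ℕ) (hs : 1 ≤ s) (a b : Fin s → ℝ) (hab : ∀ j, a j < b j)
    (γ : Finset (Fin s) → ℝ) (hγ : ∀ u, 0 < γ u) (hγ0 : γ ∅ ≤ 1)
    (p q : ℝ≥0∞) (hp : 1 ≤ p) (hq : 1 ≤ q) (hpq : 1 / p + 1 / q = 1)
    -- the target density and its unnormalized version
    (πbar π : (Fin s → ℝ) → ℝ) (z : ℝ) (hz : 0 < z)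
    (hπ : ∀ x ∈ Set.Icc a b, πbar x = π x / z)
    (hπbar_nonneg : ∀ x ∈ Set.Icc a b, 0 ≤ πbar x)
    (hπbar_int : ∫ x in Set.Icc a b, πbar x = 1)
    (hπbar_bdd : ∃ B : ℝ, ∀ x ∈ Set.Icc a b, |πbar x| ≤ B)
    (L β : ℝ) (hβ0 : 0 < β) (hβ1 : β ≤ 1)
    (hHolder : ∀ x ∈ Set.Icc a b, ∀ y ∈ Set.Icc a b, |πbar x - πbar y| ≤ L * ‖x - y‖ ^ β)
    -- the integrand
    (f : (Fin s → ℝ) → ℝ) (hf : HatQMC.HasMixedPartials a b f)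
    (hfnorm : HatQMC.weightedNorm a b γ p f < ∞)
    -- the grid; the hat function approximation is not identically zero
    (m : Fin s → ℕ) (hm : ∀ j, 1 ≤ m j)
    (hc : 0 < ∑ k, HatQMC.hatCoeff a b m π k)
    -- a nonincreasing ordering of the coefficients
    (e : Fin (Fintype.card (HatQMC.MultiIndex m)) ≃ HatQMC.MultiIndex m)
    (he : Antitone fun v => HatQMC.hatCoeff a b m π (e v))
    -- sample size and threshold
    (N : ℕ) (hN : 2 ≤ N) (δ : ℝ) (hδ0 : 0 < δ) (hδN : δ < N)
    -- the digital sequence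
    (t : ℕ) (C : Fin s → Matrix ℕ ℕ (ZMod 2)) (hC : HatQMC.GeneratesDigitalSequence t C)
    (hCtri : ∀ j, HatQMC.IsNonsingularUpperTriangular (C j)) :
    |(∫ x in Set.Icc a b, f x * πbar x) -
        HatQMC.mixtureQMC (HatQMC.hatCoeff a b m π) e (HatQMC.hatInvCDFVec a b m)
          (HatQMC.digitalPoint C) N δ f| ≤
      2 * (MeasureTheory.eLpNorm f ∞ (MeasureTheory.volume.restrict (Set.Icc a b))).toReal * L *
          (∏ j, (b j - a j)) * (⨆ j, ((b j - a j) / (m j : ℝ)) ^ β) +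
        (HatQMC.weightedNorm a b γ p f).toReal *
          ((δ + 3 * (HatQMC.mixRank (HatQMC.hatCoeff a b m π) e N δ : ℝ) - 2) / N) *
          (1 + 5 * 2 ^ t * Real.log (2 * N) * HatQMC.Gconst a b γ q N) := by
  have hbase : ∀ x ∈ Set.Icc a b, π x = z * πbar x := fun x hx => by
    rw [hπ x hx, mul_div_cancel₀ _ hz.ne']
  have hcoeff : ∀ k, HatQMC.hatCoeff a b m π k = z * HatQMC.hatCoeff a b m πbar k := fun k => by
    rw [HatQMC.hatCoeff, HatQMC.hatCoeff, ← mul_assoc]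
    exact congrArg (· * _) (hbase _ (HatQMC.gridVec_mem hab hm k))
  have hcsum : ∑ k, HatQMC.hatCoeff a b m π k = z * ∑ k, HatQMC.hatCoeff a b m πbar k := by
    rw [Finset.mul_sum]; exact Finset.sum_congr rfl fun k _ => hcoeff k
  have hcbar : 0 < ∑ k, HatQMC.hatCoeff a b m πbar k := by
    rw [hcsum] at hc; exact pos_of_mul_pos_right hc hz.le
  have hM := HatQMC.abs_mixedPartial_le hp hfnorm
  have hcont := HatQMC.continuousOn_of_mixedPartials hf hM
  have hN1 : 1 ≤ N := by omega
  have hW : 0 ≤ (HatQMC.weightedNorm a b γ p f).toReal := ENNReal.toReal_nonneg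
  have hG : 0 ≤ HatQMC.Gconst a b γ q N := ENNReal.toReal_nonneg
  have hlog : 0 ≤ Real.log (2 * N) := Real.log_nonneg (by
    have : (1 : ℝ) ≤ N := by exact_mod_cast hN1
    linarith)
  have h1 := HatQMC.abs_integral_sub_hatInterp_le hs hab hm hπbar_int hβ0 hHolder hπbar_nonneg
    hcont hcbar
  have h2 := HatQMC.abs_sum_sub_mixtureQMC_le
    (fun k => HatQMC.hatCoeff_nonneg hab hm (fun x hx => by
      rw [hbase x hx]; exact mul_nonneg hz.le (hπbar_nonneg x hx)) k) hc e
    (HatQMC.hatInvCDFVec a b m) (HatQMC.digitalPoint C) hδ0 hδN f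
    (fun k => ∫ x in Set.Icc a b,
      f x * ∏ j, HatQMC.hatDensity (a j) (b j) (m j) (k j) (x j)) hW
    (B₁ := (HatQMC.weightedNorm a b γ p f).toReal *
      (5 * 2 ^ t * Real.log (2 * N) * HatQMC.Gconst a b γ q N)) (by positivity)
    (fun k => HatQMC.abs_integral_mul_hatDensity_le hab hm
      (fun x hx => HatQMC.abs_le_weightedNorm hγ0 hp hfnorm hx) k)
    (fun k n hn => by
      -- One exponent, `Nat.log 2 N`, serves all sample sizes `n ≤ N`, so `B₁` is uniform in the
      -- component and in its sample size.
      have hlt : n < 2 ^ (Nat.log 2 N + 1) :=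
        hn.trans_lt (Nat.lt_pow_succ_log_self (by norm_num) N)
      refine (HatQMC.abs_integral_sub_sum_le hs hC hCtri
        (fun j => HatQMC.isInvCDF_hat (hab j) (hm j) (Nat.lt_succ_iff.1 (k j).2)) hf hM hlt).trans
        ?_
      have h3 := mul_le_mul_of_nonneg_left
        (HatQMC.sum_supPartial_mul_le hab hγ hp hpq hfnorm hN1)
        (by positivity : 0 ≤ 5 * 2 ^ t * Real.log (2 * N))
      rw [Finset.mul_sum] at h3
      refine le_trans (Finset.sum_le_sum fun u _ => ?_) (h3.trans (le_of_eq (by ring)))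
      rw [mul_assoc]
      exact (mul_le_mul_of_nonneg_left (HatQMC.discrepancy_bound_le hab hN t u)
        ENNReal.toReal_nonneg).trans (le_of_eq (by ring)))
  -- The unknown constant `z` scales all coefficients alike and cancels in the quotient, so the
  -- mixture target is the normalized approximation of `πbar`.
  have e1 : (∑ k, HatQMC.hatCoeff a b m π k * ∫ x in Set.Icc a b,
      f x * ∏ j, HatQMC.hatDensity (a j) (b j) (m j) (k j) (x j)) /
        ∑ k, HatQMC.hatCoeff a b m π k =
      (∫ x in Set.Icc a b, f x * HatQMC.hatInterp a b m πbar x) /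
        ∑ k, HatQMC.hatCoeff a b m πbar k := by
    rw [HatQMC.setIntegral_mul_hatInterp hab hm πbar hcont, hcsum]
    simp only [hcoeff, mul_assoc]
    rw [← Finset.mul_sum, mul_div_mul_left _ _ hz.ne']
  rw [e1] at h2
  refine (abs_sub_le _ _ _).trans ((add_le_add h1 h2).trans (le_of_eq ?_))
  ring
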